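/- Let $r$ be a positive integer and let $R=\bigoplus_{\mathbf n\in\mathbb Z^r}R_{\mathbf n}$ be a $\mathbb Z^r$-graded commutative Noetherian ring that is positively graded ($R_{\mathbf n}=0$ unless $\mathbf n\ge\mathbf 0$ componentwise) and standard ($R=R_{\mathbf 0}[R_{\mathbf e_1},\dots,R_{\mathbf e_r}]$, where $\mathbf e_1,\dots,\mathbf e_r$ is the standard basis of $\mathbb Z^r$). Write $\mathbf 1=(1,\dots,1)$. For a graded prime ideal $\mathfrak p$ of $R$, let $\operatorname{dir}(\mathfrak p)=\{j: R_{\mathbf e_j}\subseteq\mathfrak p\}=\{i_1<\dots<i_m\}$, and let $\phi(\mathfrak p):\mathbb Z^r\to\mathbb Z^m$ be the map $(n_1,\dots,n_r)\mapsto(n_{i_1},\dots,n_{i_m})$. For a homomorphism $\phi:\mathbb Z^r\to\mathbb Z^m$ and a $\mathbb Z^r$-graded object $N$ (ring, ideal or module), let $N^{\phi}$ denote the same object with the $\mathbb Z^m$-grading $(N^\phi)_{\mathbf a}=\bigoplus_{\phi(\mathbf n)=\mathbf a}N_{\mathbf n}$. Let $R_{(\mathfrak p)}$ and $M_{(\mathfrak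 p)}$ denote the homogeneous localizations at $\mathfrak p$, obtained by inverting all homogeneous elements of $R\setminus\mathfrak p$, with their natural gradings. Let ${}^*\!\operatorname{Ext}^i$ denote the $i$-th right derived functor, in the category of graded modules and homogeneous homomorphisms of degree $\mathbf 0$, of the graded Hom functor ${}^*\!\operatorname{Hom}(N,M)=\bigoplus_{\mathbf a}\{f\in\operatorname{Hom}(N,M): f(N_{\mathbf g})\subseteq M_{\mathbf g+\mathbf a}\text{ for all }\mathbf g\}$. For a graded prime $\mathfrak p\supseteq R_{\mathbf 1}R$ with $m=\#\operatorname{dir}(\mathfrak p)$, a $\mathbb Z^r$-graded $R$-module $M$ and $i\ge 0$, the set of $i$-th level anchor points of $\mathfrak p$ for $M$ is $$\operatorname{anch}^i(\mathfrak p,M)=\Big\{\mathbf a\in\mathbb Z^m:\Big(\big({}^*\!\operatorname{Ext}^i_{R_{(\mathfrak p)}}(R_{(\mathfrak p)}/\mathfrak pR_{(\mathfrak p)},M_{(\mathfrak p)})\big)^{\phi(\mathfrak p)}\Big)_{\mathbf a}\ne 0\Big\},$$ and the same definition applies to the $\mathbb Z^m$-graded ring $R^{\phi(\mathfrak p)}$,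 its graded prime ideal $\mathfrak p^{\phi(\mathfrak p)}$ and the graded module $M^{\phi(\mathfrak p)}$. **Theorem.** Let $M$ be a $\mathbb Z^r$-graded $R$-module, let $i\ge 0$, and let $\mathfrak p$ be a graded prime ideal of $R$ with $\mathfrak p\supseteq R_{\mathbf 1}R$. Put $m=\#\operatorname{dir}(\mathfrak p)$. Then $\operatorname{dir}(\mathfrak p^{\phi(\mathfrak p)})=\{1,\dots,m\}$, so that $\operatorname{anch}^i(\mathfrak p^{\phi(\mathfrak p)},M^{\phi(\mathfrak p)})$ is again a subset of $\mathbb Z^m$, and $$\operatorname{anch}^i(\mathfrak p,M)=\operatorname{anch}^i(\mathfrak p^{\phi(\mathfrak p)},M^{\phi(\mathfrak p)}).$$ Moreover, if $M$ is finitely generated, this set is finite. -/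

import Mathlib

noncomputable section

namespace MultiGraded

universe u v

/-! ### Coarsening of gradings -/

section Coarsen

variable {G H : Type} [AddCommGroup G] [AddCommGroup H]

/-- The coarsening along `φ : G → H` of a family `(𝒩_g)` of subgroups of an abelian group:
its component in degree `h` is the (internal) sum of the `𝒩_g` with `φ g = h`.  For a `G`-grading
`𝒩` this is the induced `H`-grading. -/
def coarsen {N : Type*} [AddCommGroup N] (φ : G →+ H) (𝒩 : G → AddSubgroup N) (h : H) :
    AddSubgroup N :=
  ⨆ (g : G) (_ : φ g = h), 𝒩 g

theorem le_coarsen {N : Type*} [AddCommGroup N] (φ : G →+ H) (𝒩 : G → AddSubgroup N) (g : G) :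
    𝒩 g ≤ coarsen φ 𝒩 (φ g) :=
  le_iSup₂_of_le (f := fun (g' : G) (_ : φ g' = φ g) => 𝒩 g') g rfl le_rfl

theorem coarsen_smul_mem {R M : Type*} [CommRing R] [AddCommGroup M] [Module R M]
    (φ : G →+ H) (𝒜 : G → AddSubgroup R) (ℳ : G → AddSubgroup M) [SetLike.GradedSMul 𝒜 ℳ]
    {h k : H} {a : R} {x : M} (ha : a ∈ coarsen φ 𝒜 h) (hx : x ∈ coarsen φ ℳ k) :
    a • x ∈ coarsen φ ℳ (h + k) := by
  have key : ∀ g : G, φ g = h → ∀ a ∈ 𝒜 g,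
      coarsen φ ℳ k ≤ (coarsen φ ℳ (h + k)).comap (DistribSMul.toAddMonoidHom M a) := by
    intro g hg a ha
    refine iSup₂_le fun g' hg' y hy => ?_
    have h1 : a • y ∈ ℳ (g + g') := SetLike.GradedSMul.smul_mem ha hy
    have h2 := le_coarsen φ ℳ (g + g') h1
    rw [map_add, hg, hg'] at h2
    exact h2
  have key2 : coarsen φ 𝒜 h ≤
      (coarsen φ ℳ (h + k)).comap ((AddMonoidHom.flip (smulAddHom R M)) x) :=
    iSup₂_le fun g hg a ha => key g hg a ha hx
  exact key2 ha

instance coarsen_gradedMonoid {R : Type*} [CommRing R] (φ : G →+ H) (𝒜 : G → AddSubgroup R)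
    [SetLike.GradedMonoid 𝒜] : SetLike.GradedMonoid (coarsen φ 𝒜) where
  one_mem := by
    have h := le_coarsen φ 𝒜 0 (SetLike.GradedOne.one_mem (A := 𝒜))
    rwa [map_zero] at h
  mul_mem _ _ _ _ ha hb := coarsen_smul_mem φ 𝒜 𝒜 ha hb

instance coarsen_gradedSMul {R M : Type*} [CommRing R] [AddCommGroup M] [Module R M]
    (φ : G →+ H) (𝒜 : G → AddSubgroup R) (ℳ : G → AddSubgroup M) [SetLike.GradedSMul 𝒜 ℳ] :
    SetLike.GradedSMul (coarsen φ 𝒜) (coarsen φ ℳ) where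
  smul_mem _ _ _ _ ha hx := coarsen_smul_mem φ 𝒜 ℳ ha hx

end Coarsen

/-! ### Homogeneous localization -/

section Localization

variable {G : Type} [AddCommGroup G]
variable {R : Type u} [CommRing R] (𝒜 : G → AddSubgroup R) [SetLike.GradedMonoid 𝒜]
variable (p : Ideal R) [p.IsPrime]

/-- The multiplicatively closed set of all homogeneous elements of `R` outside the prime `p`. -/
def homCompl : Submonoid R :=
  SetLike.homogeneousSubmonoid 𝒜 ⊓ p.primeCompl

/-- The homogeneous localization `R_(p)`. -/
abbrev LocRing : Type u := Localization (homCompl 𝒜 p)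

/-- The homogeneous localization `M_(p)`, a module over `R_(p)`. -/
abbrev LocMod (M : Type v) [AddCommGroup M] [Module R M] : Type (max u v) :=
  LocalizedModule (homCompl 𝒜 p) M

/-- The grading of `M_(p)`: the component of degree `g` consists of the fractions `x / s` with
`s` homogeneous outside `p`, of degree `d` say, and `x` homogeneous of degree `g + d`. -/
def locModDeg {M : Type v} [AddCommGroup M] [Module R M] (ℳ : G → AddSubgroup M)
    [SetLike.GradedSMul 𝒜 ℳ] (g : G) : AddSubgroup (LocMod 𝒜 p M) where
  carrier := {z | ∃ (d : G) (s : homCompl 𝒜 p) (x : M),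
    (s : R) ∈ 𝒜 d ∧ x ∈ ℳ (g + d) ∧ z = LocalizedModule.mk x s}
  zero_mem' := ⟨0, 1, 0, SetLike.GradedOne.one_mem, zero_mem _, by simp⟩
  add_mem' := by
    rintro _ _ ⟨d, s, x, hs, hx, rfl⟩ ⟨e, t, y, ht, hy, rfl⟩
    refine ⟨d + e, s * t, t • x + s • y, SetLike.GradedMul.mul_mem hs ht, ?_,
      LocalizedModule.mk_add_mk⟩
    have h1 : (t : R) • x ∈ ℳ (e + (g + d)) := SetLike.GradedSMul.smul_mem ht hx
    have h2 : (s : R) • y ∈ ℳ (d + (g + e)) := SetLike.GradedSMul.smul_mem hs hy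
    rw [show e + (g + d) = g + (d + e) by abel] at h1
    rw [show d + (g + e) = g + (d + e) by abel] at h2
    exact add_mem h1 h2
  neg_mem' := by
    rintro _ ⟨d, s, x, hs, hx, rfl⟩
    exact ⟨d, s, -x, hs, neg_mem hx, LocalizedModule.mk_neg.symm⟩

/-- The grading of `R_(p)`: the component of degree `g` consists of the fractions `x / s` with
`s` homogeneous outside `p`, of degree `d` say, and `x` homogeneous of degree `g + d`. -/
def locRingDeg (g : G) : AddSubgroup (LocRing 𝒜 p) where
  carrier := {z | ∃ (d : G) (s : homCompl 𝒜 p) (x : R),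
    (s : R) ∈ 𝒜 d ∧ x ∈ 𝒜 (g + d) ∧ z = Localization.mk x s}
  zero_mem' := ⟨0, 1, 0, SetLike.GradedOne.one_mem, zero_mem _, (Localization.mk_zero _).symm⟩
  add_mem' := by
    rintro _ _ ⟨d, s, x, hs, hx, rfl⟩ ⟨e, t, y, ht, hy, rfl⟩
    refine ⟨d + e, s * t, s * y + t * x, SetLike.GradedMul.mul_mem hs ht, ?_,
      Localization.add_mk _ _ _ _⟩
    have h1 : (t : R) * x ∈ 𝒜 (e + (g + d)) := SetLike.GradedMul.mul_mem ht hx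
    have h2 : (s : R) * y ∈ 𝒜 (d + (g + e)) := SetLike.GradedMul.mul_mem hs hy
    rw [show e + (g + d) = g + (d + e) by abel] at h1
    rw [show d + (g + e) = g + (d + e) by abel] at h2
    exact add_mem h2 h1
  neg_mem' := by
    rintro _ ⟨d, s, x, hs, hx, rfl⟩
    exact ⟨d, s, -x, hs, neg_mem hx, Localization.neg_mk _ _⟩

end Localization

/-! ### Graded modules, the canonical graded free resolution, and `*Ext` -/

/-- An `A`-module with a family of subgroups indexed by `G`, its homogeneous components. -/
structure GrMod (A : Type u) [CommRing A] (G : Type) where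
  carrier : Type u
  [addCommGroup : AddCommGroup carrier]
  [module : Module A carrier]
  deg : G → AddSubgroup carrier

attribute [instance] GrMod.addCommGroup GrMod.module

section Ext

variable {G : Type} [AddCommGroup G] {A : Type u} [CommRing A] (𝒜 : G → AddSubgroup A)

/-- The graded free module `⨁ A(-g)`, with one summand `A(-g)` for each homogeneous element `x`
of `N` of degree `g`: an element of degree `h` has its coefficient at `x` in `A_{h-g}`. -/
def freeCover (N : GrMod A G) : GrMod A G where
  carrier := (Σ g : G, N.deg g) →₀ A
  deg h :=
    { carrier := {f | ∀ s, f s ∈ 𝒜 (h - s.1)}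
      zero_mem' := fun _ => zero_mem _
      add_mem' := fun ha hb s => add_mem (ha s) (hb s)
      neg_mem' := fun ha s => neg_mem (ha s) }

/-- The homogeneous map of degree `0` from `freeCover N` to `N` that sends the basis element
belonging to `x` to `x`; it is surjective if `N` is generated by its homogeneous elements. -/
def coverMap (N : GrMod A G) : (freeCover 𝒜 N).carrier →ₗ[A] N.carrier :=
  Finsupp.linearCombination A fun s : Σ g : G, N.deg g => (s.2 : N.carrier)

/-- The kernel of `coverMap N`, with the grading induced from `freeCover N`. -/
def syzygy (N : GrMod A G) : GrMod A G where
  carrier := LinearMap.ker (coverMap 𝒜 N)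
  deg h := ((freeCover 𝒜 N).deg h).comap (LinearMap.ker (coverMap 𝒜 N)).subtype.toAddMonoidHom

/-- The iterated syzygies of `N`. -/
def iterSyzygy (N : GrMod A G) : ℕ → GrMod A G
  | 0 => N
  | n + 1 => syzygy 𝒜 (iterSyzygy N n)

/-- The `n`-th term of the canonical graded free resolution
`⋯ → F_1 → F_0 (→ N → 0)` of `N`. -/
abbrev resTerm (N : GrMod A G) (n : ℕ) : GrMod A G :=
  freeCover 𝒜 (iterSyzygy 𝒜 N n)

/-- The inclusion of the `(n+1)`-st syzygy into `F_n`. -/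
def syzygyIncl (N : GrMod A G) (n : ℕ) :
    (iterSyzygy 𝒜 N (n + 1)).carrier →ₗ[A] (resTerm 𝒜 N n).carrier :=
  (LinearMap.ker (coverMap 𝒜 (iterSyzygy 𝒜 N n))).subtype

/-- The differential `F_{n+1} → F_n` of the canonical graded free resolution: the composite of
the cover of the `(n+1)`-st syzygy with its inclusion into `F_n`. -/
def resDiff (N : GrMod A G) (n : ℕ) :
    (resTerm 𝒜 N (n + 1)).carrier →ₗ[A] (resTerm 𝒜 N n).carrier :=
  syzygyIncl 𝒜 N n ∘ₗ coverMap 𝒜 (iterSyzygy 𝒜 N (n + 1))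

variable {M : Type v} [AddCommGroup M] [Module A M] (ℳ : G → AddSubgroup M)

/-- `*Hom_A(F, M)_a`: the `A`-linear maps `f` with `f(F_g) ⊆ M_{g+a}` for all `g`. -/
def starHomDeg (F : GrMod A G) (a : G) : AddSubgroup (F.carrier →ₗ[A] M) where
  carrier := {f | ∀ g, ∀ x ∈ F.deg g, f x ∈ ℳ (g + a)}
  zero_mem' := fun _ _ _ => zero_mem _
  add_mem' := fun hf hg k x hx => add_mem (hf k x hx) (hg k x hx)
  neg_mem' := fun hf k x hx => neg_mem (hf k x hx)

/-- `*Hom_A(F, M)`: the sum of all `*Hom_A(F, M)_a` inside `Hom_A(F, M)`. -/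
def starHom (F : GrMod A G) : AddSubgroup (F.carrier →ₗ[A] M) :=
  ⨆ a : G, starHomDeg ℳ F a

/-- The `i`-cocycles of the complex `*Hom_A(F_•, M)`. -/
def cocycles (N : GrMod A G) (i : ℕ) : AddSubgroup ((resTerm 𝒜 N i).carrier →ₗ[A] M) where
  carrier := {f | f ∈ starHom ℳ (resTerm 𝒜 N i) ∧ f ∘ₗ resDiff 𝒜 N i = 0}
  zero_mem' := ⟨zero_mem _, LinearMap.zero_comp _⟩
  add_mem' := fun hf hg => ⟨add_mem hf.1 hg.1, by rw [LinearMap.add_comp, hf.2, hg.2, add_zero]⟩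
  neg_mem' := fun hf => ⟨neg_mem hf.1, by rw [LinearMap.neg_comp, hf.2, neg_zero]⟩

/-- The `i`-coboundaries of the complex `*Hom_A(F_•, M)`. -/
def coboundaries (N : GrMod A G) : (i : ℕ) → AddSubgroup ((resTerm 𝒜 N i).carrier →ₗ[A] M)
  | 0 => ⊥
  | i + 1 => (starHom ℳ (resTerm 𝒜 N i)).map
      (LinearMap.lcomp A M (resDiff 𝒜 N i)).toAddMonoidHom

/-- `*Ext^i_A(N, M)`, the `i`-th cohomology of `*Hom_A(F_•, M)` where `F_•` is the canonical
graded free resolution of `N`. Only its underlying abelian group and its homogeneous components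
are recorded. -/
abbrev StarExt (N : GrMod A G) (i : ℕ) : Type (max u v) :=
  cocycles 𝒜 ℳ N i ⧸ (coboundaries 𝒜 ℳ N i).addSubgroupOf (cocycles 𝒜 ℳ N i)

/-- The component of degree `a` of `*Ext^i_A(N, M)`: the classes of the cocycles of degree `a`. -/
def starExtDeg (N : GrMod A G) (i : ℕ) (a : G) : AddSubgroup (StarExt 𝒜 ℳ N i) :=
  ((starHomDeg ℳ (resTerm 𝒜 N i) a).addSubgroupOf (cocycles 𝒜 ℳ N i)).map
    (QuotientAddGroup.mk' _)

end Ext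

/-! ### Directions and anchor points -/

section Anchor

variable {R : Type u} [CommRing R] {r : ℕ} (𝒜 : (Fin r → ℤ) → AddSubgroup R)

/-- `R_n = 0` unless `n ≥ 0`. -/
def IsPositivelyGraded : Prop := ∀ n : Fin r → ℤ, ¬ 0 ≤ n → 𝒜 n = ⊥

/-- `R = R_0[R_{e_1}, …, R_{e_r}]`. -/
def IsStandard : Prop :=
  Subring.closure ((𝒜 0 : Set R) ∪ ⋃ j : Fin r, (𝒜 (Pi.single j 1) : Set R)) = ⊤

open Classical in
/-- The set `dir(p)` of `p`-directions: the `j` with `R_{e_j} ⊆ p`. -/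
def dir (p : Ideal R) : Finset (Fin r) :=
  Finset.univ.filter fun j => (𝒜 (Pi.single j 1) : Set R) ⊆ p

/-- The number of `p`-directions. -/
def numDir (p : Ideal R) : ℕ := (dir 𝒜 p).card

/-- `φ(p) : ℤ^r → ℤ^m`, `(n_1, …, n_r) ↦ (n_{i_1}, …, n_{i_m})`, where `i_1 < ⋯ < i_m` are the
`p`-directions. -/
def dirMap (p : Ideal R) : (Fin r → ℤ) →+ (Fin (numDir 𝒜 p) → ℤ) where
  toFun n k := n ((dir 𝒜 p).orderEmbOfFin rfl k)
  map_zero' := rfl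
  map_add' _ _ := rfl

variable [SetLike.GradedMonoid 𝒜] (p : Ideal R) [p.IsPrime]

/-- The graded `R_(p)`-module `R_(p) / p R_(p)`. -/
def resField : GrMod (LocRing 𝒜 p) (Fin r → ℤ) where
  carrier := LocRing 𝒜 p ⧸ p.map (algebraMap R (LocRing 𝒜 p))
  deg n := (locRingDeg 𝒜 p n).map
    (Ideal.Quotient.mk (p.map (algebraMap R (LocRing 𝒜 p)))).toAddMonoidHom

/-- `anch^i(p, M)`: the set of all `a ∈ ℤ^m`, `m` the number of `p`-directions, for which
`(*Ext^i_{R_(p)}(R_(p) / p R_(p), M_(p))^{φ(p)})_a ≠ 0`. -/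
def anch {M : Type v} [AddCommGroup M] [Module R M] (ℳ : (Fin r → ℤ) → AddSubgroup M)
    [SetLike.GradedSMul 𝒜 ℳ] (i : ℕ) : Set (Fin (numDir 𝒜 p) → ℤ) :=
  {a | coarsen (dirMap 𝒜 p)
    (starExtDeg (locRingDeg 𝒜 p) (locModDeg 𝒜 p ℳ) (resField 𝒜 p) i) a ≠ ⊥}

end Anchor

end MultiGraded

end

/-!
Let `P` be a resolution of `R ⧸ p` by graded free modules of finite rank. Its localization resolves
`R_(p) ⧸ p R_(p)`, so `*Ext^i` over `R_(p)` is nonzero in degree `n` exactly when, up to the degree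
of a homogeneous element outside `p`, some cocycle of degree `n` in `Hom(P, M)` is stable: no
homogeneous element outside `p` makes it a coboundary.

Stable classes are insensitive to coarsening the grading. A cocycle is the finite sum of its
homogeneous components, so if all of these are unstable then so is their sum; and a coarsely
homogeneous element outside `p` has a finely homogeneous component outside `p`.

Since `R` is standard, `R ⧸ p` is concentrated in degrees that vanish in every `p`-direction. Hence
homogeneous elements outside `p` have `φ(p)`-degree zero, all directions of the coarsened ring are
`p`-directions, and both sets of anchor points are the `φ(p)`-degrees of the stable classes. If `M`
is finitely generated, the cocycles are generated by finitely many homogeneous ones, and because `p`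
annihilates the cohomology of `Hom(P, M)`, the `φ(p)`-degree of a stable class is that of one of the
generators.
-/

noncomputable section

namespace MultiGraded

open DirectSum

universe u v w

/-! ### Gradings by subgroups -/

section Grading

variable {G N N' : Type*} [DecidableEq G] [AddCommGroup N] [AddCommGroup N']

theorem isInternal_iff_sum_eq_zero_and_iSup_eq_top (𝒩 : G → AddSubgroup N) :
    IsInternal 𝒩 ↔ (∀ (s : Finset G) (y : G → N), (∀ g ∈ s, y g ∈ 𝒩 g) → ∑ g ∈ s, y g = 0 →
      ∀ g ∈ s, y g = 0) ∧ ⨆ g, 𝒩 g = ⊤ := by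
  have iSup_eq_top_iff : ⨆ g, AddSubgroup.toIntSubmodule (𝒩 g) = ⊤ ↔ ⨆ g, 𝒩 g = ⊤ := by
    rw [← OrderIso.map_iSup, map_eq_top_iff]
  rw [← iSup_eq_top_iff]
  refine (isInternal_submodule_iff_iSupIndep_and_iSup_eq_top fun g =>
    AddSubgroup.toIntSubmodule (𝒩 g)).trans ?_
  rw [iSupIndep_iff_finsetSum_eq_zero_imp_eq_zero]
  rfl

/-- The projection of `N` onto its homogeneous component of degree `g`. -/
def proj (𝒩 : G → AddSubgroup N) [Decomposition 𝒩] (g : G) : N →+ N :=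
  (𝒩 g).subtype.comp ((DFinsupp.evalAddMonoidHom g).comp (decomposeAddEquiv 𝒩).toAddMonoidHom)

variable {𝒩 : G → AddSubgroup N} {𝒩' : G → AddSubgroup N'} [Decomposition 𝒩] [Decomposition 𝒩']

theorem proj_mem (g : G) (x : N) : proj 𝒩 g x ∈ 𝒩 g := SetLike.coe_mem (decompose 𝒩 x g)

theorem proj_of_mem {g : G} {x : N} (hx : x ∈ 𝒩 g) : proj 𝒩 g x = x :=
  decompose_of_mem_same 𝒩 hx

theorem proj_of_mem_of_ne {g k : G} {x : N} (hx : x ∈ 𝒩 g) (hgk : g ≠ k) : proj 𝒩 k x = 0 :=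
  decompose_of_mem_ne 𝒩 hx hgk

theorem iSup_eq_top_of_decomposition (𝒩 : G → AddSubgroup N) [Decomposition 𝒩] :
    ⨆ g, 𝒩 g = ⊤ :=
  ((isInternal_iff_sum_eq_zero_and_iSup_eq_top 𝒩).mp (Decomposition.isInternal 𝒩)).2

theorem exists_eq_sum_proj (𝒩 : G → AddSubgroup N) [Decomposition 𝒩] (x : N) :
    ∃ s : Finset G, (∀ g ∉ s, proj 𝒩 g x = 0) ∧ ∑ g ∈ s, proj 𝒩 g x = x := by
  classical
  exact ⟨(decompose 𝒩 x).support, fun g hg =>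
    congrArg Subtype.val ((DFinsupp.notMem_support_iff (f := decompose 𝒩 x)).mp hg),
    sum_support_decompose 𝒩 x⟩

theorem mem_of_forall_proj_mem {K : AddSubgroup N} {x : N} (hx : ∀ g, proj 𝒩 g x ∈ K) :
    x ∈ K := by
  obtain ⟨s, -, hs⟩ := exists_eq_sum_proj 𝒩 x
  exact hs ▸ sum_mem fun g _ => hx g

theorem eq_zero_of_forall_proj_eq_zero {x : N} (hx : ∀ g, proj 𝒩 g x = 0) : x = 0 :=
  mem_of_forall_proj_mem (K := ⊥) hx

theorem proj_sum_of_mem {ι : Type*} {s : Finset ι} {y : ι → N} {σ : ι → G}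
    (hσ : Function.Injective σ) (hy : ∀ i ∈ s, y i ∈ 𝒩 (σ i)) {i : ι} (hi : i ∈ s) :
    proj 𝒩 (σ i) (∑ j ∈ s, y j) = y i := by
  rw [map_sum, Finset.sum_eq_single_of_mem i hi, proj_of_mem (hy i hi)]
  exact fun j hj hji => proj_of_mem_of_ne (hy j hj) (hσ.ne hji)

theorem map_proj {G' : Type*} [DecidableEq G'] {𝒩' : G' → AddSubgroup N'} [Decomposition 𝒩']
    {σ : G → G'} (hσ : Function.Injective σ) (f : N →+ N')
    (hf : ∀ g, ∀ x ∈ 𝒩 g, f x ∈ 𝒩' (σ g)) (g : G) (x : N) :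
    f (proj 𝒩 g x) = proj 𝒩' (σ g) (f x) := by
  induction x using Decomposition.inductionOn 𝒩 with
  | @homogeneous k x =>
    by_cases hkg : k = g
    · subst hkg
      rw [proj_of_mem x.2, proj_of_mem (hf _ _ x.2)]
    · rw [proj_of_mem_of_ne x.2 hkg, map_zero, proj_of_mem_of_ne (hf _ _ x.2) (hσ.ne hkg)]
  | zero => simp only [map_zero]
  | add x y hx hy => simp only [map_add, hx, hy]

theorem exists_mem_apply_eq_of_mem_range {f : N →+ N'} (hf : ∀ g, ∀ x ∈ 𝒩 g, f x ∈ 𝒩' g) {g : G}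
    {y : N'} (hy : y ∈ 𝒩' g) (hyf : y ∈ f.range) : ∃ x ∈ 𝒩 g, f x = y := by
  obtain ⟨x, rfl⟩ := hyf
  refine ⟨proj 𝒩 g x, proj_mem g x, ?_⟩
  rw [map_proj (𝒩' := 𝒩') Function.injective_id f hf, id, proj_of_mem hy]

theorem isHomogeneous_ker {f : N →+ N'} (hf : ∀ g, ∀ x ∈ 𝒩 g, f x ∈ 𝒩' g) :
    SetLike.IsHomogeneous 𝒩 f.ker := by
  intro g x hx
  change f (proj 𝒩 g x) = 0
  rw [map_proj (𝒩' := 𝒩') Function.injective_id f hf, AddMonoidHom.mem_ker.mp hx, map_zero]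

/-- The grading induced on a homogeneous subgroup, given by an injective map `f`. -/
@[reducible]
def comapDecomposition {f : N' →+ N} (hf : Function.Injective f)
    (hrange : SetLike.IsHomogeneous 𝒩 f.range) : Decomposition fun g => (𝒩 g).comap f :=
  IsInternal.chooseDecomposition _ <| (isInternal_iff_sum_eq_zero_and_iSup_eq_top _).mpr <| by
    constructor
    · intro s y hy hsum g hg
      have hyg := proj_sum_of_mem (𝒩 := 𝒩) (σ := id) (y := f ∘ y) Function.injective_id hy hg
      simp only [Function.comp_apply] at hyg
      rw [← map_sum, hsum, map_zero, map_zero] at hyg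
      exact (map_eq_zero_iff f hf).mp hyg.symm
    · refine eq_top_iff.mpr fun x _ => ?_
      choose y hy using fun g => hrange g ⟨x, rfl⟩
      obtain ⟨s, -, hs⟩ := exists_eq_sum_proj 𝒩 (f x)
      have hx : x = ∑ g ∈ s, y g := hf <| by
        rw [← hs, map_sum]
        exact Finset.sum_congr rfl fun g _ => (hy g).symm
      rw [hx]
      refine sum_mem fun g _ => AddSubgroup.mem_iSup_of_mem g ?_
      rw [AddSubgroup.mem_comap, hy g]
      exact proj_mem g _

/-- The grading induced on the quotient by a homogeneous subgroup, given by a surjective map `f`. -/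
@[reducible]
def mapDecomposition {f : N →+ N'} (hf : Function.Surjective f)
    (hker : SetLike.IsHomogeneous 𝒩 f.ker) : Decomposition fun g => (𝒩 g).map f :=
  IsInternal.chooseDecomposition _ <| (isInternal_iff_sum_eq_zero_and_iSup_eq_top _).mpr <| by
    constructor
    · intro s y hy hsum g hg
      choose! x hx hxy using hy
      have hxker : ∑ k ∈ s, x k ∈ f.ker := by
        rw [AddMonoidHom.mem_ker, map_sum, Finset.sum_congr rfl hxy, hsum]
      have hxg : proj 𝒩 (id g) (∑ k ∈ s, x k) ∈ f.ker := hker g hxker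
      rwa [proj_sum_of_mem Function.injective_id hx hg, AddMonoidHom.mem_ker,
        hxy g hg] at hxg
    · rw [← AddSubgroup.map_iSup, iSup_eq_top_of_decomposition,
        AddSubgroup.map_top_of_surjective f hf]

end Grading

section Coarsen

variable {G H : Type} [AddCommGroup G] [AddCommGroup H] {N : Type*} [AddCommGroup N]
  {φ : G →+ H} {𝒩 : G → AddSubgroup N} {h : H}

@[elab_as_elim]
theorem coarsen_induction {motive : N → Prop} {x : N} (hx : x ∈ coarsen φ 𝒩 h)
    (mem : ∀ g, φ g = h → ∀ x ∈ 𝒩 g, motive x) (zero : motive 0)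
    (add : ∀ x y, motive x → motive y → motive (x + y)) : motive x :=
  AddSubgroup.iSup_induction (C := motive) _ hx (fun g _ hx =>
    AddSubgroup.iSup_induction (C := motive) _ hx (fun hg x hx => mem g hg x hx) zero add) zero add

theorem coarsen_eq_bot_iff : coarsen φ 𝒩 h = ⊥ ↔ ∀ g, φ g = h → 𝒩 g = ⊥ := by
  simp only [coarsen, iSup_eq_bot]

variable [DecidableEq G]

theorem proj_eq_zero_of_mem_coarsen [Decomposition 𝒩] {x : N} (hx : x ∈ coarsen φ 𝒩 h) {g : G}
    (hg : φ g ≠ h) : proj 𝒩 g x = 0 := by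
  refine coarsen_induction hx ?_ (map_zero _) fun x y hx hy => by rw [map_add, hx, hy, add_zero]
  exact fun k hk x hx => proj_of_mem_of_ne hx fun hkg => hg (hkg ▸ hk)

instance coarsenDecomposition [DecidableEq H] (φ : G →+ H) (𝒩 : G → AddSubgroup N)
    [Decomposition 𝒩] : Decomposition (coarsen φ 𝒩) :=
  IsInternal.chooseDecomposition _ <| (isInternal_iff_sum_eq_zero_and_iSup_eq_top _).mpr <| by
    constructor
    · intro s y hy hsum h hh
      refine eq_zero_of_forall_proj_eq_zero (𝒩 := 𝒩) fun g => ?_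
      by_cases hg : φ g = h
      · have hother : ∀ k ∈ s, k ≠ h → proj 𝒩 g (y k) = 0 := fun k hk hkh =>
          proj_eq_zero_of_mem_coarsen (hy k hk) fun hgk => hkh (hgk ▸ hg)
        rw [← Finset.sum_eq_single_of_mem h hh hother, ← map_sum, hsum, map_zero]
      · exact proj_eq_zero_of_mem_coarsen (hy h hh) hg
    · rw [eq_top_iff, ← iSup_eq_top_of_decomposition 𝒩]
      exact iSup_le fun g => (le_coarsen φ 𝒩 g).trans (le_iSup (coarsen φ 𝒩) (φ g))

theorem proj_proj_coarsen [DecidableEq H] [Decomposition 𝒩] (g : G) (x : N) :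
    proj 𝒩 g (proj (coarsen φ 𝒩) (φ g) x) = proj 𝒩 g x := by
  induction x using Decomposition.inductionOn 𝒩 with
  | @homogeneous k x =>
    have hx : (x : N) ∈ coarsen φ 𝒩 (φ k) := le_coarsen φ 𝒩 k x.2
    by_cases hkg : φ k = φ g
    · rw [← hkg, proj_of_mem hx]
    · rw [proj_of_mem_of_ne hx hkg, map_zero, proj_of_mem_of_ne x.2 fun h => hkg (h ▸ rfl)]
  | zero => simp only [map_zero]
  | add x y hx hy => simp only [map_add, hx, hy]

theorem isHomogeneous_coarsen [DecidableEq H] [Decomposition 𝒩] {K : AddSubgroup N}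
    (hK : SetLike.IsHomogeneous 𝒩 K) : SetLike.IsHomogeneous (coarsen φ 𝒩) K := by
  intro h x hx
  refine mem_of_forall_proj_mem (𝒩 := 𝒩) fun g => ?_
  change proj 𝒩 g (proj (coarsen φ 𝒩) h x) ∈ K
  by_cases hg : φ g = h
  · rw [← hg, proj_proj_coarsen]
    exact hK g hx
  · rw [proj_eq_zero_of_mem_coarsen (proj_mem h x) hg]
    exact zero_mem K

end Coarsen

/-! ### Graded free modules -/

section GradedSMul

variable {G A M : Type*} [AddCommGroup G] [CommRing A] [AddCommGroup M] [Module A M]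
  {𝒜 : G → AddSubgroup A} {ℳ : G → AddSubgroup M} [SetLike.GradedSMul 𝒜 ℳ]

theorem smul_mem_of_add_eq {g h k : G} {a : A} {x : M} (ha : a ∈ 𝒜 g) (hx : x ∈ ℳ h)
    (hk : g + h = k) : a • x ∈ ℳ k :=
  hk ▸ SetLike.GradedSMul.smul_mem ha hx

theorem proj_smul_of_mem_left [DecidableEq G] [Decomposition ℳ] {g h k : G} {a : A}
    (ha : a ∈ 𝒜 g) (x : M) (hk : g + h = k) : proj ℳ k (a • x) = a • proj ℳ h x := by
  subst hk
  exact (map_proj (add_right_injective g) (DistribSMul.toAddMonoidHom M a)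
    (fun _ _ hx => smul_mem_of_add_eq ha hx rfl) h x).symm

theorem proj_smul_of_mem_right [DecidableEq G] [Decomposition 𝒜] [Decomposition ℳ] {g h k : G}
    (a : A) {x : M} (hx : x ∈ ℳ h) (hk : g + h = k) :
    proj ℳ k (a • x) = proj 𝒜 g a • x := by
  subst hk
  exact (map_proj (add_left_injective h) ((smulAddHom A M).flip x)
    (fun _ _ ha => smul_mem_of_add_eq ha hx rfl) g a).symm

end GradedSMul

section Free

variable {G A M : Type*} {ι κ : Type*} [AddCommGroup G] [CommRing A] [AddCommGroup M] [Module A M]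

/-- The grading of the free module on `ι` whose basis vector `j` has degree `δ j`. -/
def freeDeg (𝒜 : G → AddSubgroup A) (δ : ι → G) (h : G) : AddSubgroup (ι →₀ A) where
  carrier := {f | ∀ j, f j ∈ 𝒜 (h - δ j)}
  zero_mem' := fun _ => zero_mem _
  add_mem' := fun ha hb j => add_mem (ha j) (hb j)
  neg_mem' := fun ha j => neg_mem (ha j)

/-- The linear maps of degree `a` from the free module on `ι`, whose basis vector `j` has degree
`δ j`, to the graded module `ℳ`. -/
def homDeg (δ : ι → G) (ℳ : G → AddSubgroup M) (a : G) : AddSubgroup ((ι →₀ A) →ₗ[A] M) where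
  carrier := {f | ∀ j, f (Finsupp.single j 1) ∈ ℳ (δ j + a)}
  zero_mem' := fun _ => zero_mem _
  add_mem' := fun hf hg j => add_mem (hf j) (hg j)
  neg_mem' := fun hf j => neg_mem (hf j)

variable {𝒜 : G → AddSubgroup A} {ℳ : G → AddSubgroup M} {δ : ι → G} {a g : G}

theorem single_mem_freeDeg {j : ι} {x : A} (hx : x ∈ 𝒜 (g - δ j)) :
    Finsupp.single j x ∈ freeDeg 𝒜 δ g := by
  classical
  intro k
  rw [Finsupp.single_apply]
  split_ifs with hjk
  · exact hjk ▸ hx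
  · exact zero_mem _

theorem single_one_mem_freeDeg [SetLike.GradedMonoid 𝒜] (δ : ι → G) (j : ι) :
    Finsupp.single j 1 ∈ freeDeg 𝒜 δ (δ j) :=
  single_mem_freeDeg (by simpa only [sub_self] using SetLike.GradedOne.one_mem)

instance freeDeg_gradedSMul [SetLike.GradedMonoid 𝒜] (δ : ι → G) :
    SetLike.GradedSMul 𝒜 (freeDeg 𝒜 δ) where
  smul_mem _ _ _ _ ha hx j := smul_mem_of_add_eq ha (hx j) (add_sub_assoc _ _ _).symm

instance freeDegDecomposition [DecidableEq G] [Decomposition 𝒜] (δ : ι → G) :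
    Decomposition (freeDeg 𝒜 δ) :=
  IsInternal.chooseDecomposition _ <| (isInternal_iff_sum_eq_zero_and_iSup_eq_top _).mpr <| by
    constructor
    · intro s y hy hsum g hg
      ext j
      have hyg := proj_sum_of_mem (𝒩 := 𝒜) (σ := fun k => k - δ j) (y := fun k => y k j)
        sub_left_injective (fun k hk => hy k hk j) hg
      rw [← hyg, ← Finsupp.finsetSum_apply, hsum, Finsupp.zero_apply, map_zero]
    · refine eq_top_iff.mpr fun f _ => ?_
      induction f using Finsupp.induction_linear with
      | zero => exact zero_mem _
      | add f g hf hg => exact add_mem (hf trivial) (hg trivial)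
      | single j x =>
        obtain ⟨s, -, hs⟩ := exists_eq_sum_proj 𝒜 x
        rw [← hs, Finsupp.single_finsetSum]
        refine sum_mem fun g _ => AddSubgroup.mem_iSup_of_mem (g + δ j) (single_mem_freeDeg ?_)
        rw [add_sub_cancel_right]
        exact proj_mem g x

theorem apply_eq_sum_smul_single (f : (ι →₀ A) →ₗ[A] M) (x : ι →₀ A) :
    f x = ∑ j ∈ x.support, x j • f (Finsupp.single j 1) := by
  simp only [← map_smul, Finsupp.smul_single_one, ← map_sum]
  exact congrArg f x.sum_single.symm

theorem apply_mem_of_mem_homDeg [SetLike.GradedSMul 𝒜 ℳ] {f : (ι →₀ A) →ₗ[A] M}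
    (hf : f ∈ homDeg δ ℳ a) {x : ι →₀ A} (hx : x ∈ freeDeg 𝒜 δ g) : f x ∈ ℳ (g + a) := by
  rw [apply_eq_sum_smul_single]
  exact sum_mem fun j _ => smul_mem_of_add_eq (hx j) (hf j) (by abel)

theorem apply_mem_of_mem_homDeg_zero [SetLike.GradedSMul 𝒜 ℳ] {f : (ι →₀ A) →ₗ[A] M}
    (hf : f ∈ homDeg δ ℳ 0) {x : ι →₀ A} (hx : x ∈ freeDeg 𝒜 δ g) : f x ∈ ℳ g := by
  simpa only [add_zero] using apply_mem_of_mem_homDeg hf hx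

theorem comp_mem_homDeg_zero [SetLike.GradedSMul 𝒜 ℳ] {δ' : κ → G} {f : (ι →₀ A) →ₗ[A] M}
    (hf : f ∈ homDeg δ ℳ a) {d : (κ →₀ A) →ₗ[A] (ι →₀ A)} (hd : d ∈ homDeg δ' (freeDeg 𝒜 δ) 0) :
    f ∘ₗ d ∈ homDeg δ' ℳ a := fun k => by
  have hfd := apply_mem_of_mem_homDeg hf (hd k)
  rwa [add_zero] at hfd

theorem smul_mem_homDeg [SetLike.GradedSMul 𝒜 ℳ] {c : A} (hc : c ∈ 𝒜 g) {f : (ι →₀ A) →ₗ[A] M}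
    (hf : f ∈ homDeg δ ℳ a) : c • f ∈ homDeg δ ℳ (g + a) := fun j =>
  smul_mem_of_add_eq hc (hf j) (by abel)

theorem exists_comp_eq_of_range_le {P Q Q' : Type*} [AddCommGroup P] [Module A P]
    [Module.Projective A P] [AddCommGroup Q] [Module A Q] [AddCommGroup Q'] [Module A Q']
    {d : Q →ₗ[A] Q'} {f : P →ₗ[A] Q'} (hfd : LinearMap.range f ≤ LinearMap.range d) :
    ∃ u : P →ₗ[A] Q, d ∘ₗ u = f := by
  obtain ⟨u, hu⟩ := Module.projective_lifting_property d.rangeRestrict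
    (f.codRestrict (LinearMap.range d) fun x => hfd ⟨x, rfl⟩) d.surjective_rangeRestrict
  exact ⟨u, LinearMap.ext fun x => congrArg Subtype.val (LinearMap.congr_fun hu x)⟩

theorem exists_homDeg_comp_eq_of_range_le [DecidableEq G] [SetLike.GradedSMul 𝒜 ℳ]
    [Decomposition 𝒜] [Decomposition ℳ] {δ' : κ → G} {d : (ι →₀ A) →ₗ[A] M}
    (hd : d ∈ homDeg δ ℳ 0) {f : (κ →₀ A) →ₗ[A] M} (hf : f ∈ homDeg δ' ℳ 0)
    (hfd : LinearMap.range f ≤ LinearMap.range d) :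
    ∃ u ∈ homDeg δ' (freeDeg 𝒜 δ) 0, d ∘ₗ u = f := by
  have exists_lift (k : κ) : ∃ y ∈ freeDeg 𝒜 δ (δ' k + 0), d y = f (Finsupp.single k 1) :=
    exists_mem_apply_eq_of_mem_range (f := d.toAddMonoidHom) (𝒩' := ℳ)
      (fun _ _ => apply_mem_of_mem_homDeg_zero hd) (hf k) (hfd ⟨_, rfl⟩)
  choose y hy hdy using exists_lift
  refine ⟨Finsupp.linearCombination A y, fun k => ?_,
    Finsupp.lhom_ext' fun k => LinearMap.ext_ring ?_⟩
  · simpa using hy k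
  · simpa using hdy k

section LinearComponent

variable [DecidableEq G] [Decomposition ℳ]

/-- The homogeneous component of degree `a` of a linear map on a graded free module. -/
def linearComponent (δ : ι → G) (ℳ : G → AddSubgroup M) [Decomposition ℳ] (a : G)
    (f : (ι →₀ A) →ₗ[A] M) : (ι →₀ A) →ₗ[A] M :=
  Finsupp.linearCombination A fun j => proj ℳ (δ j + a) (f (Finsupp.single j 1))

@[simp]
theorem linearComponent_single_one (f : (ι →₀ A) →ₗ[A] M) (j : ι) :
    linearComponent δ ℳ a f (Finsupp.single j 1) = proj ℳ (δ j + a) (f (Finsupp.single j 1)) := by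
  simp [linearComponent]

theorem linearComponent_mem (f : (ι →₀ A) →ₗ[A] M) : linearComponent δ ℳ a f ∈ homDeg δ ℳ a :=
  fun j => by
    rw [linearComponent_single_one]
    exact proj_mem _ _

theorem linearComponent_add (f f' : (ι →₀ A) →ₗ[A] M) :
    linearComponent δ ℳ a (f + f') = linearComponent δ ℳ a f + linearComponent δ ℳ a f' :=
  Finsupp.lhom_ext' fun j => LinearMap.ext_ring <| by simp

theorem linearComponent_of_mem {f : (ι →₀ A) →ₗ[A] M} (hf : f ∈ homDeg δ ℳ a) :
    linearComponent δ ℳ a f = f :=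
  Finsupp.lhom_ext' fun j => LinearMap.ext_ring <|
    (linearComponent_single_one f j).trans (proj_of_mem (hf j))

theorem linearComponent_apply [SetLike.GradedSMul 𝒜 ℳ] (f : (ι →₀ A) →ₗ[A] M) {x : ι →₀ A}
    (hx : x ∈ freeDeg 𝒜 δ g) : linearComponent δ ℳ a f x = proj ℳ (g + a) (f x) := by
  rw [apply_eq_sum_smul_single, apply_eq_sum_smul_single f, map_sum]
  refine Finset.sum_congr rfl fun j _ => ?_
  rw [linearComponent_single_one, proj_smul_of_mem_left (h := δ j + a) (hx j) _ (by abel)]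

theorem linearComponent_comp [SetLike.GradedSMul 𝒜 ℳ] {δ' : κ → G} (f : (ι →₀ A) →ₗ[A] M)
    {d : (κ →₀ A) →ₗ[A] (ι →₀ A)} (hd : d ∈ homDeg δ' (freeDeg 𝒜 δ) 0) :
    linearComponent δ ℳ a f ∘ₗ d = linearComponent δ' ℳ a (f ∘ₗ d) := by
  refine Finsupp.lhom_ext' fun k => LinearMap.ext_ring ?_
  simp only [LinearMap.comp_apply, Finsupp.lsingle_apply, linearComponent_single_one]
  rw [linearComponent_apply f (hd k), add_zero]

end LinearComponent

end Free

/-! ### Graded free resolutions -/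

section Resolution

theorem exists_dependent_seq {X : ℕ → Type*} (x₀ : X 0) {r : ∀ n, X n → X (n + 1) → Prop}
    (hr : ∀ n x, ∃ y, r n x y) : ∃ x : ∀ n, X n, x 0 = x₀ ∧ ∀ n, r n (x n) (x (n + 1)) := by
  choose f hf using hr
  exact ⟨fun n => Nat.rec x₀ f n, rfl, fun n => hf n _⟩

variable {G A N : Type*} [AddCommGroup G] [CommRing A] [AddCommGroup N] [Module A N]

/-- A graded free resolution `⋯ → P₁ → P₀ → N → 0` of a graded module, with chosen homogeneous
bases: `P n` is free on `ι n` and its basis vector `j` has degree `δ n j`. -/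
structure GradedFreeResolution (𝒜 : G → AddSubgroup A) (𝒩 : G → AddSubgroup N) where
  ι : ℕ → Type w
  δ : ∀ n, ι n → G
  d : ∀ n, (ι (n + 1) →₀ A) →ₗ[A] (ι n →₀ A)
  ε : (ι 0 →₀ A) →ₗ[A] N
  d_mem : ∀ n, d n ∈ homDeg (δ (n + 1)) (freeDeg 𝒜 (δ n)) 0
  ε_mem : ε ∈ homDeg (δ 0) 𝒩 0
  ε_surjective : Function.Surjective ε
  exact_zero : Function.Exact (d 0) ε
  exact_succ : ∀ n, Function.Exact (d (n + 1)) (d n)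

namespace GradedFreeResolution

variable {𝒜 : G → AddSubgroup A} {𝒩 : G → AddSubgroup N} {M : Type*} [AddCommGroup M] [Module A M]

/-- The `i`-cocycles of the complex `Hom(P, M)`. -/
def homCocycles (P : GradedFreeResolution 𝒜 𝒩) (M : Type*) [AddCommGroup M] [Module A M] (i : ℕ) :
    Submodule A ((P.ι i →₀ A) →ₗ[A] M) :=
  LinearMap.ker (LinearMap.lcomp A M (P.d i))

/-- The `i`-coboundaries of the complex `Hom(P, M)`. -/
def homCoboundaries (P : GradedFreeResolution 𝒜 𝒩) (M : Type*) [AddCommGroup M] [Module A M] :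
    ∀ i : ℕ, Submodule A ((P.ι i →₀ A) →ₗ[A] M)
  | 0 => ⊥
  | i + 1 => LinearMap.range (LinearMap.lcomp A M (P.d i))

/-- The degrees in which the `i`-th cohomology of `Hom(P, M)` does not vanish. -/
def extSupport (P : GradedFreeResolution 𝒜 𝒩) (ℳ : G → AddSubgroup M) (i : ℕ) : Set G :=
  {a | ∃ f ∈ homDeg (P.δ i) ℳ a, f ∈ P.homCocycles M i ∧ f ∉ P.homCoboundaries M i}

theorem mem_homCocycles {P : GradedFreeResolution 𝒜 𝒩} {i : ℕ} {f : (P.ι i →₀ A) →ₗ[A] M} :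
    f ∈ P.homCocycles M i ↔ f ∘ₗ P.d i = 0 :=
  Iff.rfl

universe w₁ w₂

theorem exists_chainMap [DecidableEq G] [SetLike.GradedMonoid 𝒜] [Decomposition 𝒜]
    [SetLike.GradedSMul 𝒜 𝒩] [Decomposition 𝒩] (P : GradedFreeResolution.{w₁} 𝒜 𝒩)
    (Q : GradedFreeResolution.{w₂} 𝒜 𝒩) :
    ∃ u : ∀ n, (P.ι n →₀ A) →ₗ[A] (Q.ι n →₀ A),
      (∀ n, u n ∈ homDeg (P.δ n) (freeDeg 𝒜 (Q.δ n)) 0) ∧ Q.ε ∘ₗ u 0 = P.ε ∧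
      ∀ n, Q.d n ∘ₗ u (n + 1) = u n ∘ₗ P.d n := by
  obtain ⟨u₀, hu₀, hεu₀⟩ := exists_homDeg_comp_eq_of_range_le (𝒜 := 𝒜) Q.ε_mem P.ε_mem
    (le_top.trans_eq (LinearMap.range_eq_top.mpr Q.ε_surjective).symm)
  let X (n : ℕ) := {u : (P.ι n →₀ A) →ₗ[A] (Q.ι n →₀ A) //
    u ∈ homDeg (P.δ n) (freeDeg 𝒜 (Q.δ n)) 0 ∧
      LinearMap.range (u ∘ₗ P.d n) ≤ LinearMap.range (Q.d n)}
  let x₀ : X 0 := ⟨u₀, hu₀, by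
    rintro _ ⟨x, rfl⟩
    refine (Q.exact_zero _).mp ?_
    rw [LinearMap.comp_apply, ← LinearMap.comp_apply Q.ε, hεu₀,
      P.exact_zero.apply_apply_eq_zero]⟩
  obtain ⟨u, hu0, hu⟩ := exists_dependent_seq x₀
    (r := fun n (u : X n) (u' : X (n + 1)) => Q.d n ∘ₗ u'.1 = u.1 ∘ₗ P.d n) (by
      rintro n ⟨u, hu, hrange⟩
      obtain ⟨u', hu', hdu'⟩ := exists_homDeg_comp_eq_of_range_le (𝒜 := 𝒜) (Q.d_mem n)
        (comp_mem_homDeg_zero hu (P.d_mem n)) hrange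
      refine ⟨⟨u', hu', ?_⟩, hdu'⟩
      rintro _ ⟨x, rfl⟩
      refine (Q.exact_succ n _).mp ?_
      rw [LinearMap.comp_apply, ← LinearMap.comp_apply (Q.d n), hdu', LinearMap.comp_apply,
        (P.exact_succ n).apply_apply_eq_zero, map_zero])
  refine ⟨fun n => (u n).1, fun n => (u n).2.1, ?_, hu⟩
  simpa only [hu0] using hεu₀

variable {P : GradedFreeResolution.{w₁} 𝒜 𝒩} {Q : GradedFreeResolution.{w₂} 𝒜 𝒩}
  {u : ∀ n, (P.ι n →₀ A) →ₗ[A] (Q.ι n →₀ A)} {i : ℕ}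

theorem exists_homotopy (hε : Q.ε ∘ₗ u 0 = 0) (hu : ∀ n, Q.d n ∘ₗ u (n + 1) = u n ∘ₗ P.d n) :
    ∃ s : ∀ n, (P.ι n →₀ A) →ₗ[A] (Q.ι (n + 1) →₀ A), Q.d 0 ∘ₗ s 0 = u 0 ∧
      ∀ n, Q.d (n + 1) ∘ₗ s (n + 1) = u (n + 1) - s n ∘ₗ P.d n := by
  have hu' (n : ℕ) (x) : Q.d n (u (n + 1) x) = u n (P.d n x) := LinearMap.congr_fun (hu n) x
  obtain ⟨s₀, hs₀⟩ := exists_comp_eq_of_range_le (d := Q.d 0) (f := u 0) (by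
    rintro _ ⟨x, rfl⟩
    exact (Q.exact_zero _).mp (LinearMap.congr_fun hε x))
  let X (n : ℕ) := {s : (P.ι n →₀ A) →ₗ[A] (Q.ι (n + 1) →₀ A) //
    LinearMap.range (u (n + 1) - s ∘ₗ P.d n) ≤ LinearMap.range (Q.d (n + 1))}
  let x₀ : X 0 := ⟨s₀, by
    rintro _ ⟨x, rfl⟩
    refine (Q.exact_succ 0 _).mp ?_
    rw [LinearMap.sub_apply, map_sub, hu', LinearMap.comp_apply, ← LinearMap.comp_apply (Q.d 0),
      hs₀, sub_self]⟩
  obtain ⟨s, hs0, hs⟩ := exists_dependent_seq x₀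
    (r := fun n (s : X n) (s' : X (n + 1)) => Q.d (n + 1) ∘ₗ s'.1 = u (n + 1) - s.1 ∘ₗ P.d n) (by
      rintro n ⟨s, hrange⟩
      obtain ⟨s', hs'⟩ := exists_comp_eq_of_range_le hrange
      refine ⟨⟨s', ?_⟩, hs'⟩
      rintro _ ⟨x, rfl⟩
      refine (Q.exact_succ (n + 1) _).mp ?_
      rw [LinearMap.sub_apply, map_sub, hu', LinearMap.comp_apply,
        ← LinearMap.comp_apply (Q.d (n + 1)), hs', LinearMap.sub_apply, LinearMap.comp_apply,
        (P.exact_succ n).apply_apply_eq_zero, map_zero, sub_zero, sub_self])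
  refine ⟨fun n => (s n).1, ?_, hs⟩
  simpa only [hs0] using hs₀

theorem comp_mem_homCoboundaries_of_lifts_zero (hε : Q.ε ∘ₗ u 0 = 0)
    (hu : ∀ n, Q.d n ∘ₗ u (n + 1) = u n ∘ₗ P.d n) {f : (Q.ι i →₀ A) →ₗ[A] M}
    (hf : f ∈ Q.homCocycles M i) : f ∘ₗ u i ∈ P.homCoboundaries M i := by
  obtain ⟨s, hs0, hs⟩ := exists_homotopy hε hu
  rw [mem_homCocycles] at hf
  cases i with
  | zero =>
    change f ∘ₗ u 0 = 0
    rw [← hs0, ← LinearMap.comp_assoc, hf, LinearMap.zero_comp]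
  | succ i =>
    refine ⟨f ∘ₗ s i, (sub_eq_zero.mp ?_).symm⟩
    rw [LinearMap.lcomp_apply', LinearMap.comp_assoc, ← LinearMap.comp_sub, ← hs,
      ← LinearMap.comp_assoc, hf, LinearMap.zero_comp]

theorem comp_mem_homCoboundaries (hu : ∀ n, Q.d n ∘ₗ u (n + 1) = u n ∘ₗ P.d n)
    {f : (Q.ι i →₀ A) →ₗ[A] M} (hf : f ∈ Q.homCoboundaries M i) :
    f ∘ₗ u i ∈ P.homCoboundaries M i := by
  cases i with
  | zero =>
    change f ∘ₗ u 0 = 0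
    rw [show f = 0 from hf, LinearMap.zero_comp]
  | succ i =>
    obtain ⟨g, rfl⟩ := hf
    exact ⟨g ∘ₗ u i, by simp only [LinearMap.lcomp_apply', LinearMap.comp_assoc, hu]⟩

theorem smul_mem_homCoboundaries_of_annihilates (P : GradedFreeResolution 𝒜 𝒩) {c : A}
    (hc : ∀ x : N, c • x = 0) {f : (P.ι i →₀ A) →ₗ[A] M} (hf : f ∈ P.homCocycles M i) :
    c • f ∈ P.homCoboundaries M i := by
  have h := comp_mem_homCoboundaries_of_lifts_zero (P := P) (u := fun _ => c • LinearMap.id)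
    (LinearMap.ext fun x => by simp [hc]) (fun n => LinearMap.ext fun x => by simp) hf
  rwa [LinearMap.comp_smul, LinearMap.comp_id] at h

variable [DecidableEq G] [SetLike.GradedMonoid 𝒜] [Decomposition 𝒜] [SetLike.GradedSMul 𝒜 𝒩]
  [Decomposition 𝒩] {ℳ : G → AddSubgroup M} [SetLike.GradedSMul 𝒜 ℳ]

theorem extSupport_subset (P : GradedFreeResolution.{w₁} 𝒜 𝒩)
    (Q : GradedFreeResolution.{w₂} 𝒜 𝒩) : P.extSupport ℳ i ⊆ Q.extSupport ℳ i := by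
  rintro a ⟨f, hfa, hf, hf'⟩
  obtain ⟨u, hu_deg, hεu, hu⟩ := Q.exists_chainMap P
  obtain ⟨v, -, hεv, hv⟩ := P.exists_chainMap Q
  refine ⟨f ∘ₗ u i, comp_mem_homDeg_zero hfa (hu_deg i), ?_,
    fun hfu => hf' ?_⟩
  · rw [mem_homCocycles] at hf ⊢
    rw [LinearMap.comp_assoc, ← hu, ← LinearMap.comp_assoc, hf, LinearMap.zero_comp]
  · have hfuv : f ∘ₗ u i ∘ₗ v i ∈ P.homCoboundaries M i := comp_mem_homCoboundaries hv hfu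
    have hsub : f ∘ₗ (LinearMap.id - u i ∘ₗ v i) ∈ P.homCoboundaries M i :=
      comp_mem_homCoboundaries_of_lifts_zero (u := fun n => LinearMap.id - u n ∘ₗ v n)
        (by rw [LinearMap.comp_sub, ← LinearMap.comp_assoc, hεu, hεv, LinearMap.comp_id, sub_self])
        (fun n => by
          rw [LinearMap.comp_sub, LinearMap.sub_comp, ← LinearMap.comp_assoc, hu,
            LinearMap.comp_assoc, hv, LinearMap.comp_assoc, LinearMap.comp_id,
            LinearMap.id_comp]) hf
    simpa only [LinearMap.comp_sub, LinearMap.comp_id, sub_add_cancel] using add_mem hsub hfuv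

theorem extSupport_eq (P : GradedFreeResolution.{w₁} 𝒜 𝒩) (Q : GradedFreeResolution.{w₂} 𝒜 𝒩) :
    P.extSupport ℳ i = Q.extSupport ℳ i :=
  (P.extSupport_subset Q).antisymm (Q.extSupport_subset P)

end GradedFreeResolution

end Resolution

/-! ### The canonical resolution -/

section Canonical

variable {G : Type} [AddCommGroup G] {A : Type u} [CommRing A] {𝒜 : G → AddSubgroup A}
  {N : GrMod A G}

theorem coverMap_single_one (s : Σ g : G, N.deg g) :
    coverMap 𝒜 N (Finsupp.single s (1 : A)) = s.2 :=
  (Finsupp.linearCombination_single A (1 : A) s).trans (one_smul _ _)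

theorem coverMap_mem_homDeg :
    coverMap 𝒜 N ∈ homDeg (Sigma.fst : (Σ g : G, N.deg g) → G) N.deg 0 := fun s => by
  change coverMap 𝒜 N (Finsupp.single s (1 : A)) ∈ _
  rw [coverMap_single_one, add_zero]
  exact s.2.2

theorem coverMap_surjective [DecidableEq G] [Decomposition N.deg] :
    Function.Surjective (coverMap 𝒜 N) := by
  have iSup_le_range : ⨆ g, N.deg g ≤ (coverMap 𝒜 N).toAddMonoidHom.range :=
    iSup_le fun g x hx =>
      ⟨Finsupp.single ⟨g, x, hx⟩ (1 : A), coverMap_single_one (𝒜 := 𝒜) ⟨g, x, hx⟩⟩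
  rw [iSup_eq_top_of_decomposition] at iSup_le_range
  exact fun x => iSup_le_range (AddSubgroup.mem_top x)

variable [SetLike.GradedMonoid 𝒜]

instance syzygy_gradedSMul : SetLike.GradedSMul 𝒜 (syzygy 𝒜 N).deg where
  smul_mem _ _ _ _ ha hx :=
    (freeDeg_gradedSMul (𝒜 := 𝒜) (Sigma.fst : (Σ g : G, N.deg g) → G)).smul_mem ha hx

instance iterSyzygy_gradedSMul [SetLike.GradedSMul 𝒜 N.deg] :
    ∀ n, SetLike.GradedSMul 𝒜 (iterSyzygy 𝒜 N n).deg
  | 0 => ‹SetLike.GradedSMul 𝒜 N.deg›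
  | n + 1 => syzygy_gradedSMul (N := iterSyzygy 𝒜 N n)

variable {M : Type v} [AddCommGroup M] [Module A M] {ℳ : G → AddSubgroup M}
  [SetLike.GradedSMul 𝒜 ℳ] {i : ℕ} {a : G}

theorem mem_starHomDeg_iff_mem_homDeg {f : (freeCover 𝒜 N).carrier →ₗ[A] M} :
    f ∈ starHomDeg ℳ (freeCover 𝒜 N) a ↔
      f ∈ homDeg (Sigma.fst : (Σ g : G, N.deg g) → G) ℳ a :=
  ⟨fun hf s => hf _ _ (single_one_mem_freeDeg (𝒜 := 𝒜) (Sigma.fst : (Σ g : G, N.deg g) → G) s),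
    fun hf _ _ hx => apply_mem_of_mem_homDeg (𝒜 := 𝒜) hf hx⟩

variable [DecidableEq G] [Decomposition 𝒜]

instance syzygyDecomposition [SetLike.GradedSMul 𝒜 N.deg] [Decomposition N.deg] :
    Decomposition (syzygy 𝒜 N).deg :=
  comapDecomposition (𝒩 := freeDeg 𝒜 (Sigma.fst : (Σ g : G, N.deg g) → G))
    (f := (LinearMap.ker (coverMap 𝒜 N)).subtype.toAddMonoidHom) Subtype.val_injective <| by
    have hker := isHomogeneous_ker (𝒩 := freeDeg 𝒜 (Sigma.fst : (Σ g : G, N.deg g) → G))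
      (𝒩' := N.deg) (f := (coverMap 𝒜 N).toAddMonoidHom)
      fun _ _ => apply_mem_of_mem_homDeg_zero (coverMap_mem_homDeg (𝒜 := 𝒜))
    rintro g _ ⟨x, rfl⟩
    exact ⟨⟨proj (freeDeg 𝒜 _) g x.1, hker g x.2⟩, rfl⟩

instance iterSyzygyDecomposition [SetLike.GradedSMul 𝒜 N.deg] [Decomposition N.deg] :
    ∀ n, Decomposition (iterSyzygy 𝒜 N n).deg
  | 0 => ‹Decomposition N.deg›
  | n + 1 =>
    letI := iterSyzygyDecomposition n
    syzygyDecomposition (N := iterSyzygy 𝒜 N n)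

theorem exact_resDiff_coverMap [SetLike.GradedSMul 𝒜 N.deg] [Decomposition N.deg] (n : ℕ) :
    Function.Exact (resDiff 𝒜 N n) (coverMap 𝒜 (iterSyzygy 𝒜 N n)) := by
  intro x
  constructor
  · intro hx
    obtain ⟨y, hy⟩ := coverMap_surjective (𝒜 := 𝒜) (N := iterSyzygy 𝒜 N (n + 1)) ⟨x, hx⟩
    exact ⟨y, congrArg Subtype.val hy⟩
  · rintro ⟨y, rfl⟩
    exact (coverMap 𝒜 (iterSyzygy 𝒜 N (n + 1)) y).2

/-- The resolution underlying the definition of `StarExt`: the basis of its `n`-th term consists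
of all homogeneous elements of the `n`-th syzygy. -/
def canonicalResolution (𝒜 : G → AddSubgroup A) [SetLike.GradedMonoid 𝒜] [Decomposition 𝒜]
    (N : GrMod A G) [SetLike.GradedSMul 𝒜 N.deg] [Decomposition N.deg] :
    GradedFreeResolution.{u} 𝒜 N.deg where
  ι n := Σ g : G, (iterSyzygy 𝒜 N n).deg g
  δ _ := Sigma.fst
  d n := resDiff 𝒜 N n
  ε := coverMap 𝒜 N
  d_mem n := coverMap_mem_homDeg (𝒜 := 𝒜) (N := iterSyzygy 𝒜 N (n + 1))
  ε_mem := coverMap_mem_homDeg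
  ε_surjective := coverMap_surjective
  exact_zero := exact_resDiff_coverMap 0
  exact_succ n x := (map_eq_zero_iff (syzygyIncl 𝒜 N n) Subtype.val_injective).trans
    (exact_resDiff_coverMap (n + 1) x)

variable [SetLike.GradedSMul 𝒜 N.deg] [Decomposition N.deg] [Decomposition ℳ]

theorem mem_coboundaries_iff_mem_homCoboundaries {f : (resTerm 𝒜 N i).carrier →ₗ[A] M}
    (hf : f ∈ starHomDeg ℳ (resTerm 𝒜 N i) a) : f ∈ coboundaries 𝒜 ℳ N i ↔
      f ∈ (canonicalResolution 𝒜 N).homCoboundaries M i := by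
  cases i with
  | zero => exact AddSubgroup.mem_bot
  | succ i =>
    refine ⟨fun ⟨g, _, hg⟩ => ⟨g, hg⟩, ?_⟩
    rintro ⟨g, rfl⟩
    refine ⟨linearComponent ((canonicalResolution 𝒜 N).δ i) ℳ a g,
      AddSubgroup.mem_iSup_of_mem a
        ((mem_starHomDeg_iff_mem_homDeg (𝒜 := 𝒜)).mpr (linearComponent_mem g)), ?_⟩
    exact (linearComponent_comp g ((canonicalResolution 𝒜 N).d_mem i)).trans
      (linearComponent_of_mem (mem_starHomDeg_iff_mem_homDeg.mp hf))

theorem starExtDeg_ne_bot_iff :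
    starExtDeg 𝒜 ℳ N i a ≠ ⊥ ↔ a ∈ (canonicalResolution 𝒜 N).extSupport ℳ i := by
  rw [Ne, starExtDeg, AddSubgroup.map_eq_bot_iff, QuotientAddGroup.ker_mk',
    SetLike.not_le_iff_exists]
  constructor
  · rintro ⟨f, hfa, hf⟩
    exact ⟨f.1, mem_starHomDeg_iff_mem_homDeg.mp hfa, f.2.2, fun hf' =>
      hf ((mem_coboundaries_iff_mem_homCoboundaries hfa).mpr hf')⟩
  · rintro ⟨f, hfa, hf, hf'⟩
    have hfa' : f ∈ starHomDeg ℳ (resTerm 𝒜 N i) a :=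
      (mem_starHomDeg_iff_mem_homDeg (𝒜 := 𝒜)).mpr hfa
    exact ⟨⟨f, AddSubgroup.mem_iSup_of_mem a hfa', hf⟩, hfa', fun hf'' =>
      hf' ((mem_coboundaries_iff_mem_homCoboundaries hfa').mp hf'')⟩

end Canonical

/-! ### Resolutions of finite rank -/

section FiniteResolution

variable {G A N : Type*} [DecidableEq G] [CommRing A] [AddCommGroup N] [Module A N]
  {𝒜 : G → AddSubgroup A} {𝒩 : G → AddSubgroup N} [Decomposition 𝒩]

theorem span_homogeneous_elements {K : Submodule A N} (hK : SetLike.IsHomogeneous 𝒩 K) :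
    Submodule.span A {x | x ∈ K ∧ ∃ g, x ∈ 𝒩 g} = K := by
  refine le_antisymm (Submodule.span_le.mpr fun x hx => hx.1) fun x hx => ?_
  exact mem_of_forall_proj_mem (𝒩 := 𝒩) (K := (Submodule.span A _).toAddSubgroup) fun g =>
    Submodule.subset_span ⟨hK g hx, g, proj_mem g x⟩

variable [AddCommGroup G]

theorem exists_homDeg_range_eq {K : Submodule A N} (hfg : K.FG)
    (hK : SetLike.IsHomogeneous 𝒩 K) :
    ∃ (k : ℕ) (δ : Fin k → G) (d : (Fin k →₀ A) →ₗ[A] N),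
      d ∈ homDeg δ 𝒩 0 ∧ LinearMap.range d = K := by
  rw [← span_homogeneous_elements hK, Submodule.fg_span_iff_fg_span_finset_subset] at hfg
  obtain ⟨s, hs, hspan⟩ := hfg
  choose δ hδ using fun j : Fin s.card => (hs (s.equivFin.symm j).2).2
  refine ⟨s.card, δ, Finsupp.linearCombination A fun j => (s.equivFin.symm j : N), fun j => ?_, ?_⟩
  · simpa using hδ j
  · have hrange : Set.range (fun j => (s.equivFin.symm j : N)) = s :=
      (s.equivFin.symm.surjective.range_comp Subtype.val).trans Subtype.range_coe
    rw [Finsupp.range_linearCombination, hrange, ← hspan, span_homogeneous_elements hK]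

variable [Decomposition 𝒜]

theorem isHomogeneous_ker_of_mem_homDeg [SetLike.GradedSMul 𝒜 𝒩] {ι : Type*} {δ : ι → G}
    {d : (ι →₀ A) →ₗ[A] N} (hd : d ∈ homDeg δ 𝒩 0) :
    SetLike.IsHomogeneous (freeDeg 𝒜 δ) (LinearMap.ker d) := fun g _ hx =>
  isHomogeneous_ker (f := d.toAddMonoidHom) (𝒩' := 𝒩)
    (fun _ _ => apply_mem_of_mem_homDeg_zero hd) g hx

/-- A graded free module of finite rank with a homogeneous submodule: the data from which one step
of a resolution is built. -/
structure FreeStage (𝒜 : G → AddSubgroup A) [Decomposition 𝒜] where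
  rank : ℕ
  δ : Fin rank → G
  K : Submodule A (Fin rank →₀ A)
  isHomogeneous : SetLike.IsHomogeneous (freeDeg 𝒜 δ) K

variable [SetLike.GradedMonoid 𝒜] [IsNoetherianRing A]

theorem FreeStage.exists_next (S : FreeStage 𝒜) :
    ∃ (S' : FreeStage 𝒜) (d : (Fin S'.rank →₀ A) →ₗ[A] (Fin S.rank →₀ A)),
      d ∈ homDeg S'.δ (freeDeg 𝒜 S.δ) 0 ∧ LinearMap.range d = S.K ∧ LinearMap.ker d = S'.K := by
  obtain ⟨k, δ, d, hd, hrange⟩ :=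
    exists_homDeg_range_eq (IsNoetherian.noetherian S.K) S.isHomogeneous
  exact ⟨⟨k, δ, LinearMap.ker d, isHomogeneous_ker_of_mem_homDeg hd⟩, d, hd, hrange, rfl⟩

theorem exists_finite_resolution [Module.Finite A N] [SetLike.GradedSMul 𝒜 𝒩] :
    ∃ P : GradedFreeResolution.{0} 𝒜 𝒩, ∀ n, Finite (P.ι n) := by
  obtain ⟨k, δ, ε, hε, hrange⟩ := exists_homDeg_range_eq (𝒩 := 𝒩) (Module.Finite.fg_top (R := A))
    fun _ _ _ => Submodule.mem_top
  choose next d hd hd_range hd_ker using FreeStage.exists_next (𝒜 := 𝒜)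
  let S (n : ℕ) : FreeStage 𝒜 := n.rec
    ⟨k, δ, LinearMap.ker ε, isHomogeneous_ker_of_mem_homDeg hε⟩ fun _ => next
  exact ⟨{ ι := fun n => Fin (S n).rank
           δ := fun n => (S n).δ
           d := fun n => d (S n)
           ε := ε
           d_mem := fun n => hd (S n)
           ε_mem := hε
           ε_surjective := LinearMap.range_eq_top.mp hrange
           exact_zero := LinearMap.exact_iff.mpr (hd_range (S 0)).symm
           exact_succ := fun n =>
            LinearMap.exact_iff.mpr ((hd_ker (S n)).trans (hd_range (S (n + 1))).symm) },
    fun n => inferInstanceAs (Finite (Fin (S n).rank))⟩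

end FiniteResolution

section Quotient

variable {G A : Type*} [CommRing A]

/-- The grading of the quotient ring `A ⧸ I`. -/
abbrev quotDeg (𝒜 : G → AddSubgroup A) (I : Ideal A) (g : G) : AddSubgroup (A ⧸ I) :=
  (𝒜 g).map (Ideal.Quotient.mk I).toAddMonoidHom

instance quotDeg_gradedSMul [AddMonoid G] {𝒜 : G → AddSubgroup A} [SetLike.GradedMonoid 𝒜]
    (I : Ideal A) : SetLike.GradedSMul 𝒜 (quotDeg 𝒜 I) where
  smul_mem := by
    rintro g h a _ ha ⟨x, hx, rfl⟩
    exact ⟨a * x, SetLike.GradedMul.mul_mem ha hx, rfl⟩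

/-- The quotient of a graded ring by a homogeneous ideal is graded. -/
@[reducible]
def quotDecomposition [DecidableEq G] {𝒜 : G → AddSubgroup A} [Decomposition 𝒜] {I : Ideal A}
    (hI : SetLike.IsHomogeneous 𝒜 I) : Decomposition (quotDeg 𝒜 I) :=
  mapDecomposition Ideal.Quotient.mk_surjective fun g _ hx =>
    Ideal.Quotient.eq_zero_iff_mem.mpr (hI g (Ideal.Quotient.eq_zero_iff_mem.mp hx))

end Quotient

/-! ### Homogeneous localization -/

section Fractions

variable {G R M M' : Type*} [AddCommGroup G] [CommRing R] [AddCommGroup M] [Module R M]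
  [AddCommGroup M'] [Module R M']

/-- `ℳ'` is the grading of the localization `l : M → M'` at `S` by the degrees of fractions: an
element has degree `g` if it is `x / s` with `s` homogeneous of degree `d` and `x` of degree
`g + d`. -/
def IsFractionGrading (𝒜 : G → AddSubgroup R) (S : Submonoid R) (ℳ : G → AddSubgroup M)
    (ℳ' : G → AddSubgroup M') (l : M →ₗ[R] M') : Prop :=
  ∀ g z, z ∈ ℳ' g ↔ ∃ (d : G) (s : S) (x : M), (s : R) ∈ 𝒜 d ∧ x ∈ ℳ (g + d) ∧ s • z = l x

namespace IsFractionGrading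

variable {𝒜 : G → AddSubgroup R} [SetLike.GradedMonoid 𝒜] {S : Submonoid R}
  {ℳ : G → AddSubgroup M} {ℳ' : G → AddSubgroup M'} {l : M →ₗ[R] M'}

theorem map_mem (h : IsFractionGrading 𝒜 S ℳ ℳ' l) {g : G} {x : M} (hx : x ∈ ℳ g) :
    l x ∈ ℳ' g :=
  (h g _).mpr ⟨0, 1, x, SetLike.GradedOne.one_mem, by rwa [add_zero], one_smul _ _⟩

variable [SetLike.GradedSMul 𝒜 ℳ]

theorem exists_common_denominator (h : IsFractionGrading 𝒜 S ℳ ℳ' l) {ι : Type*} (F : Finset ι)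
    {z : ι → M'} {σ : ι → G} (hz : ∀ i ∈ F, z i ∈ ℳ' (σ i)) :
    ∃ (d : G) (s : S), (s : R) ∈ 𝒜 d ∧ ∀ i ∈ F, ∃ y ∈ ℳ (σ i + d), s • z i = l y := by
  classical
  induction F using Finset.induction_on with
  | empty => exact ⟨0, 1, SetLike.GradedOne.one_mem, by simp⟩
  | insert i F hi ih =>
    obtain ⟨d, s, hs, hF⟩ := ih fun j hj => hz j (Finset.mem_insert_of_mem hj)
    obtain ⟨e, t, x, ht, hx, htz⟩ := (h _ _).mp (hz i (Finset.mem_insert_self i F))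
    refine ⟨d + e, s * t, SetLike.GradedMul.mul_mem hs ht, fun j hj => ?_⟩
    rcases Finset.mem_insert.mp hj with rfl | hj
    · refine ⟨(s : R) • x, smul_mem_of_add_eq hs hx (by abel), ?_⟩
      rw [mul_smul, htz, map_smul, Submonoid.smul_def]
    · obtain ⟨y, hy, hsy⟩ := hF j hj
      refine ⟨(t : R) • y, smul_mem_of_add_eq ht hy (by abel), ?_⟩
      rw [mul_comm, mul_smul, hsy, map_smul, Submonoid.smul_def]

theorem isInternal [DecidableEq G] [Decomposition ℳ] [IsLocalizedModule S l]
    (h : IsFractionGrading 𝒜 S ℳ ℳ' l) (hS : ∀ s : S, ∃ d, (s : R) ∈ 𝒜 d) : IsInternal ℳ' := by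
  refine (isInternal_iff_sum_eq_zero_and_iSup_eq_top ℳ').mpr ⟨?_, eq_top_iff.mpr ?_⟩
  · intro F z hz hsum g hg
    obtain ⟨d, s, _, hF⟩ := h.exists_common_denominator F (σ := id) hz
    choose! y hy hsy using hF
    have hly : l (∑ g ∈ F, y g) = 0 := by
      rw [map_sum, ← Finset.sum_congr rfl hsy, ← Finset.smul_sum, hsum, smul_zero]
    obtain ⟨t, ht⟩ := (IsLocalizedModule.eq_zero_iff S l).mp hly
    obtain ⟨e, hte⟩ := hS t
    have hty : t • y g = 0 := by
      rw [Finset.smul_sum] at ht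
      rw [← proj_sum_of_mem (𝒩 := ℳ) (σ := fun g => e + (g + d)) (y := fun g => t • y g)
        (fun a b hab => add_right_cancel (add_left_cancel hab))
        (fun g hg => smul_mem_of_add_eq hte (hy g hg) rfl) hg, ht, map_zero]
    refine IsLocalizedModule.smul_injective l s (?_ : s • z g = s • 0)
    rw [smul_zero, hsy g hg]
    exact (IsLocalizedModule.eq_zero_iff S l).mpr ⟨t, hty⟩
  · rintro z -
    obtain ⟨⟨x, s⟩, rfl⟩ := IsLocalizedModule.mk'_surjective S l z
    obtain ⟨d, hd⟩ := hS s
    change IsLocalizedModule.mk' l x s ∈ _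
    induction x using Decomposition.inductionOn ℳ with
    | @homogeneous g x =>
      exact AddSubgroup.mem_iSup_of_mem (g - d) ((h _ _).mpr
        ⟨d, s, x, hd, by simp, IsLocalizedModule.mk'_cancel' l (x : M) s⟩)
    | zero => rw [IsLocalizedModule.mk'_zero]; exact zero_mem _
    | add x y hx hy => rw [IsLocalizedModule.mk'_add]; exact add_mem hx hy

end IsFractionGrading

end Fractions

section HomogeneousLocalization

variable {G : Type} [AddCommGroup G] {R : Type u} [CommRing R] {𝒜 : G → AddSubgroup R}
  [SetLike.GradedMonoid 𝒜] {p : Ideal R} [p.IsPrime] {M : Type v} [AddCommGroup M] [Module R M]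
  {ℳ : G → AddSubgroup M} [SetLike.GradedSMul 𝒜 ℳ]

theorem isFractionGrading_locModDeg : IsFractionGrading 𝒜 (homCompl 𝒜 p) ℳ (locModDeg 𝒜 p ℳ)
    (LocalizedModule.mkLinearMap (homCompl 𝒜 p) M) := by
  intro g z
  refine exists_congr fun d => exists_congr fun s => exists_congr fun x =>
    and_congr_right fun _ => and_congr_right fun _ => ?_
  rw [IsLocalizedModule.mk_eq_mk', eq_comm, IsLocalizedModule.mk'_eq_iff, eq_comm]

theorem isFractionGrading_locRingDeg : IsFractionGrading 𝒜 (homCompl 𝒜 p) 𝒜 (locRingDeg 𝒜 p)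
    (Algebra.linearMap R (LocRing 𝒜 p)) := by
  intro g z
  refine exists_congr fun d => exists_congr fun s => exists_congr fun x =>
    and_congr_right fun _ => and_congr_right fun _ => ?_
  rw [Localization.mk_eq_mk', eq_comm, IsLocalization.mk'_eq_iff_eq_mul, eq_comm, mul_comm,
    ← Algebra.smul_def, Submonoid.smul_def, Algebra.linearMap_apply]

theorem algebraMap_mem_locRingDeg {g : G} {x : R} (hx : x ∈ 𝒜 g) :
    algebraMap R (LocRing 𝒜 p) x ∈ locRingDeg 𝒜 p g :=
  isFractionGrading_locRingDeg.map_mem hx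

instance locRingDegDecomposition [DecidableEq G] [Decomposition 𝒜] :
    Decomposition (locRingDeg 𝒜 p) :=
  (isFractionGrading_locRingDeg.isInternal fun s => s.2.1).chooseDecomposition

instance locModDegDecomposition [DecidableEq G] [Decomposition ℳ] :
    Decomposition (locModDeg 𝒜 p ℳ) :=
  (isFractionGrading_locModDeg.isInternal fun s => s.2.1).chooseDecomposition

instance locModDeg_gradedSMul : SetLike.GradedSMul (locRingDeg 𝒜 p) (locModDeg 𝒜 p ℳ) where
  smul_mem := by
    rintro g h _ _ ⟨d, s, x, hs, hx, rfl⟩ ⟨e, t, y, ht, hy, rfl⟩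
    refine ⟨d + e, s * t, x • y, SetLike.GradedMul.mul_mem hs ht,
      smul_mem_of_add_eq hx hy ?_, LocalizedModule.mk_smul_mk _ _ _ _⟩
    rw [vadd_eq_add]
    abel

instance locRingDeg_gradedMonoid : SetLike.GradedMonoid (locRingDeg 𝒜 p) where
  one_mem := by
    rw [← map_one (algebraMap R (LocRing 𝒜 p))]
    exact algebraMap_mem_locRingDeg SetLike.GradedOne.one_mem
  mul_mem := by
    rintro g h _ _ ⟨d, s, x, hs, hx, rfl⟩ ⟨e, t, y, ht, hy, rfl⟩
    exact ⟨d + e, s * t, x * y, SetLike.GradedMul.mul_mem hs ht,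
      smul_mem_of_add_eq hx hy (by abel), Localization.mk_mul _ _ _ _⟩

variable (p) in
theorem isHomogeneous_map_algebraMap [DecidableEq G] [Decomposition 𝒜]
    (hp : SetLike.IsHomogeneous 𝒜 p) :
    SetLike.IsHomogeneous (locRingDeg 𝒜 p) (p.map (algebraMap R (LocRing 𝒜 p))) := by
  intro g z hz
  obtain ⟨⟨⟨a, ha⟩, s⟩, hs⟩ := (IsLocalization.mem_map_algebraMap_iff (homCompl 𝒜 p) _).mp hz
  obtain ⟨d, hd⟩ := s.2.1
  change proj (locRingDeg 𝒜 p) g z ∈ _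
  refine (IsLocalization.mem_map_algebraMap_iff (homCompl 𝒜 p) _).mpr
    ⟨⟨⟨proj 𝒜 (d + g) a, hp _ ha⟩, s⟩, ?_⟩
  have hproj : algebraMap R (LocRing 𝒜 p) (proj 𝒜 (d + g) a) =
      proj (locRingDeg 𝒜 p) (d + g) (algebraMap R (LocRing 𝒜 p) a) :=
    map_proj (𝒩 := 𝒜) Function.injective_id (algebraMap R (LocRing 𝒜 p)).toAddMonoidHom
      (fun _ _ => algebraMap_mem_locRingDeg) (d + g) a
  rw [hproj, ← hs, mul_comm, mul_comm z]
  exact (proj_smul_of_mem_left (algebraMap_mem_locRingDeg (p := p) hd) z rfl).symm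

end HomogeneousLocalization

section LocalizedResolution

variable {A : Type*} (B : Type*) [CommRing A] [CommRing B] [Algebra A B] (S : Submonoid A)
  [IsLocalization S B]

theorem mem_localized'_iff_of_smul_eq {M M' : Type*} [AddCommGroup M] [Module A M]
    [AddCommGroup M'] [Module A M'] [Module B M'] [IsScalarTower A B M'] {l : M →ₗ[A] M'}
    [IsLocalizedModule S l] {K : Submodule A M} {s : S} {x : M} {z : M'} (hz : s • z = l x) :
    z ∈ K.localized' B S l ↔ ∃ t : S, t • x ∈ K := by
  obtain rfl : IsLocalizedModule.mk' l x s = z := IsLocalizedModule.mk'_eq_iff.mpr hz.symm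
  rw [Submodule.mem_localized']
  constructor
  · rintro ⟨y, hy, t, hyt⟩
    obtain ⟨c, hc⟩ := (IsLocalizedModule.mk'_eq_mk'_iff l y x t s).mp hyt
    exact ⟨c * t, by rw [mul_smul, hc]; exact K.smul_mem _ (K.smul_mem _ hy)⟩
  · rintro ⟨t, ht⟩
    exact ⟨t • x, ht, t * s, IsLocalizedModule.mk'_cancel_left l x t s⟩

/-- The localization map of the free module on `ι`. -/
abbrev freeLocalization (A B : Type*) [CommRing A] [CommRing B] [Algebra A B] (ι : Type*) :
    (ι →₀ A) →ₗ[A] (ι →₀ B) :=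
  Finsupp.mapRange.linearMap (Algebra.linearMap A B)

theorem freeLocalization_single_one {ι : Type*} (j : ι) :
    freeLocalization A B ι (Finsupp.single j 1) = Finsupp.single j 1 := by
  simp

variable {M M' : Type*} [AddCommGroup M] [Module A M] [AddCommGroup M'] [Module A M'] [Module B M']
  [IsScalarTower A B M'] (l : M →ₗ[A] M') [IsLocalizedModule S l] {ι κ : Type*}

/-- The localization of linear maps out of the free module on `ι`. -/
abbrev localizeHom (ι : Type*) : ((ι →₀ A) →ₗ[A] M) →ₗ[A] ((ι →₀ B) →ₗ[B] M') :=
  IsLocalizedModule.mapExtendScalars S (freeLocalization A B ι) l B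

theorem localizeHom_apply (f : (ι →₀ A) →ₗ[A] M) (x : ι →₀ A) :
    localizeHom B S l ι f (freeLocalization A B ι x) = l (f x) := by
  simp only [IsLocalizedModule.mapExtendScalars_apply_apply, IsLocalizedModule.map_apply]

theorem localizeHom_single_one (f : (ι →₀ A) →ₗ[A] M) (j : ι) :
    localizeHom B S l ι f (Finsupp.single j 1) = l (f (Finsupp.single j 1)) := by
  rw [← freeLocalization_single_one (A := A), localizeHom_apply]

theorem localizeHom_comp (f : (ι →₀ A) →ₗ[A] M) (d : (κ →₀ A) →ₗ[A] (ι →₀ A)) :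
    localizeHom B S l κ (f ∘ₗ d) =
      localizeHom B S l ι f ∘ₗ localizeHom B S (freeLocalization A B ι) κ d := by
  ext j
  simp only [LinearMap.comp_apply, Finsupp.lsingle_apply, localizeHom_single_one,
    localizeHom_apply]

namespace GradedFreeResolution

variable {G N N' : Type*} [AddCommGroup G] [AddCommGroup N] [Module A N] [AddCommGroup N']
  [Module A N'] [Module B N'] [IsScalarTower A B N'] {𝒜 : G → AddSubgroup A}
  {ℬ : G → AddSubgroup B} {𝒩 : G → AddSubgroup N} {𝒩' : G → AddSubgroup N'}

variable {B} in
/-- The localization of a graded free resolution. -/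
def localize (P : GradedFreeResolution.{w} 𝒜 𝒩)
    (hℬ : ∀ g, ∀ x ∈ 𝒜 g, algebraMap A B x ∈ ℬ g) (l : N →ₗ[A] N') [IsLocalizedModule S l]
    (h𝒩 : ∀ g, ∀ x ∈ 𝒩 g, l x ∈ 𝒩' g) : GradedFreeResolution.{w} ℬ 𝒩' where
  ι := P.ι
  δ := P.δ
  d n := localizeHom B S (freeLocalization A B (P.ι n)) (P.ι (n + 1)) (P.d n)
  ε := localizeHom B S l (P.ι 0) P.ε
  d_mem n j := by
    rw [localizeHom_single_one]
    exact fun k => hℬ _ _ (P.d_mem n j k)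
  ε_mem j := by
    rw [localizeHom_single_one]
    exact h𝒩 _ _ (P.ε_mem j)
  ε_surjective := IsLocalizedModule.map_surjective S (freeLocalization A B (P.ι 0)) l P.ε
    P.ε_surjective
  exact_zero := IsLocalizedModule.map_exact S (freeLocalization A B (P.ι 1))
    (freeLocalization A B (P.ι 0)) l _ _ P.exact_zero
  exact_succ n := IsLocalizedModule.map_exact S (freeLocalization A B (P.ι (n + 2)))
    (freeLocalization A B (P.ι (n + 1))) (freeLocalization A B (P.ι n)) _ _ (P.exact_succ n)

variable (P : GradedFreeResolution.{w} 𝒜 𝒩) [∀ n, Finite (P.ι n)]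

theorem extendScalars_map_lcomp_d (i : ℕ) :
    (IsLocalizedModule.map S (localizeHom B S l (P.ι i)) (localizeHom B S l (P.ι (i + 1)))
      (LinearMap.lcomp A M (P.d i))).extendScalarsOfIsLocalization S B =
    LinearMap.lcomp B M'
      (localizeHom B S (freeLocalization A B (P.ι i)) (P.ι (i + 1)) (P.d i)) := by
  apply LinearMap.restrictScalars_injective A
  refine IsLocalizedModule.linearMap_ext S (localizeHom B S l (P.ι i))
    (localizeHom B S l (P.ι (i + 1))) (LinearMap.ext fun f => ?_)
  rw [LinearMap.comp_apply, LinearMap.comp_apply, LinearMap.restrictScalars_apply,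
    LinearMap.restrictScalars_apply, LinearMap.extendScalarsOfIsLocalization_apply',
    IsLocalizedModule.map_apply]
  exact localizeHom_comp B S l f (P.d i)

variable {B} (hℬ : ∀ g, ∀ x ∈ 𝒜 g, algebraMap A B x ∈ ℬ g) (lN : N →ₗ[A] N')
  [IsLocalizedModule S lN] (h𝒩 : ∀ g, ∀ x ∈ 𝒩 g, lN x ∈ 𝒩' g)

theorem homCocycles_localize (i : ℕ) : (P.localize S hℬ lN h𝒩).homCocycles M' i =
    (P.homCocycles M i).localized' B S (localizeHom B S l (P.ι i)) := by
  rw [homCocycles, homCocycles, LinearMap.localized'_ker_eq_ker_localizedMap B S _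
    (localizeHom B S l (P.ι (i + 1))), extendScalars_map_lcomp_d]
  rfl

theorem homCoboundaries_localize (i : ℕ) : (P.localize S hℬ lN h𝒩).homCoboundaries M' i =
    (P.homCoboundaries M i).localized' B S (localizeHom B S l (P.ι i)) := by
  cases i with
  | zero => exact (Submodule.localized'_bot B S (localizeHom B S l (P.ι 0))).symm
  | succ i =>
    rw [homCoboundaries, homCoboundaries, LinearMap.localized'_range_eq_range_localizedMap B S
      (localizeHom B S l (P.ι i)), extendScalars_map_lcomp_d]
    rfl

/-- The degrees of the cocycles of `Hom(P, M)` whose class is killed by no element of `S`. -/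
def stableDegrees (P : GradedFreeResolution 𝒜 𝒩) (S : Submonoid A) (ℳ : G → AddSubgroup M)
    (i : ℕ) : Set G :=
  {a | ∃ f ∈ homDeg (P.δ i) ℳ a, f ∈ P.homCocycles M i ∧ ∀ t ∈ S, t • f ∉ P.homCoboundaries M i}

variable [SetLike.GradedMonoid 𝒜] {ℳ : G → AddSubgroup M} [SetLike.GradedSMul 𝒜 ℳ]
  {ℳ' : G → AddSubgroup M'} {l}

theorem exists_smul_eq_localizeHom [Finite ι] (hℳ : IsFractionGrading 𝒜 S ℳ ℳ' l) {δ : ι → G}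
    {a : G} {f' : (ι →₀ B) →ₗ[B] M'} (hf' : f' ∈ homDeg δ ℳ' a) :
    ∃ (d : G) (s : S), (s : A) ∈ 𝒜 d ∧
      ∃ f ∈ homDeg δ ℳ (a + d), s • f' = localizeHom B S l ι f := by
  have := Fintype.ofFinite ι
  obtain ⟨d, s, hs, hy⟩ := hℳ.exists_common_denominator Finset.univ fun j _ => hf' j
  choose y hy hsy using fun j => hy j (Finset.mem_univ j)
  refine ⟨d, s, hs, Finsupp.linearCombination A y, fun j => ?_, ?_⟩
  · rw [Finsupp.linearCombination_single, one_smul, ← add_assoc]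
    exact hy j
  · ext j
    rw [LinearMap.comp_apply, LinearMap.comp_apply, Finsupp.lsingle_apply,
      localizeHom_single_one, Finsupp.linearCombination_single, one_smul]
    exact hsy j

theorem mem_extSupport_localize_iff (hℳ : IsFractionGrading 𝒜 S ℳ ℳ' l)
    (hS : ∀ s : S, ∃ d, (s : A) ∈ 𝒜 d) {i : ℕ} {a : G} :
    a ∈ (P.localize S hℬ lN h𝒩).extSupport ℳ' i ↔
      ∃ d, ∃ s ∈ S, s ∈ 𝒜 d ∧ a + d ∈ P.stableDegrees S ℳ i := by
  simp only [extSupport, homCocycles_localize S l, homCoboundaries_localize S l]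
  constructor
  · rintro ⟨f', hf'_deg, hf', hf'_cob⟩
    obtain ⟨d, s, hs, f, hf_deg, hsf⟩ := exists_smul_eq_localizeHom S (ι := P.ι i) hℳ hf'_deg
    obtain ⟨t, ht⟩ := (mem_localized'_iff_of_smul_eq B S hsf).mp hf'
    obtain ⟨e, he⟩ := hS t
    refine ⟨e + d, t * s, mul_mem t.2 s.2, SetLike.GradedMul.mul_mem he hs, t • f,
      (add_left_comm e a d) ▸ smul_mem_homDeg he hf_deg, ht, fun c hc hcf => hf'_cob ?_⟩
    exact (mem_localized'_iff_of_smul_eq B S hsf).mpr ⟨⟨c, hc⟩ * t, by rwa [mul_smul]⟩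
  · rintro ⟨d, s, hsS, hs, f, hf_deg, hf, hf_cob⟩
    have hsf := IsLocalizedModule.mk'_cancel' (localizeHom B S l (P.ι i)) f ⟨s, hsS⟩
    refine ⟨_, fun j => (hℳ _ _).mpr ⟨d, ⟨s, hsS⟩, f (Finsupp.single j 1), hs, ?_, ?_⟩,
      (mem_localized'_iff_of_smul_eq B S hsf).mpr ⟨1, by rwa [one_smul]⟩, fun hcob => ?_⟩
    · rw [add_assoc]
      exact hf_deg j
    · exact (LinearMap.congr_fun hsf _).trans (localizeHom_single_one B S l f j)
    · obtain ⟨t, ht⟩ := (mem_localized'_iff_of_smul_eq B S hsf).mp hcob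
      exact hf_cob t t.2 ht

end GradedFreeResolution

end LocalizedResolution

section ResidueRing

/-- The localization map `A ⧸ I → B ⧸ IB`. -/
def quotLocalization {A : Type*} (B : Type*) [CommRing A] [CommRing B] [Algebra A B]
    (S : Submonoid A) [IsLocalization S B] (I : Ideal A) :
    A ⧸ I →ₗ[A] B ⧸ I.map (algebraMap A B) :=
  ((Submodule.quotEquivOfEq _ _ (Ideal.localized'_eq_map B S I)).restrictScalars A).toLinearMap ∘ₗ
    Submodule.toLocalizedQuotient' B S (Algebra.linearMap A B) I

instance quotLocalization_isLocalizedModule {A : Type*} (B : Type*) [CommRing A] [CommRing B]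
    [Algebra A B] (S : Submonoid A) [IsLocalization S B] (I : Ideal A) :
    IsLocalizedModule S (quotLocalization B S I) :=
  IsLocalizedModule.of_linearEquiv ..

variable {r : ℕ} {R : Type u} [CommRing R] {𝒜 : (Fin r → ℤ) → AddSubgroup R}
  [SetLike.GradedMonoid 𝒜] [Decomposition 𝒜] {p : Ideal R} [p.IsPrime] {M : Type v}
  [AddCommGroup M] [Module R M] {ℳ : (Fin r → ℤ) → AddSubgroup M} [SetLike.GradedSMul 𝒜 ℳ]
  [Decomposition ℳ]

theorem starExtDeg_resField_ne_bot_iff (hp : SetLike.IsHomogeneous 𝒜 p)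
    (P : GradedFreeResolution.{w} 𝒜 (quotDeg 𝒜 p)) [∀ n, Finite (P.ι n)] {i : ℕ}
    {a : Fin r → ℤ} :
    starExtDeg (locRingDeg 𝒜 p) (locModDeg 𝒜 p ℳ) (resField 𝒜 p) i a ≠ ⊥ ↔
      ∃ d, ∃ s ∈ homCompl 𝒜 p, s ∈ 𝒜 d ∧ a + d ∈ P.stableDegrees (homCompl 𝒜 p) ℳ i := by
  let : Decomposition (resField 𝒜 p).deg := quotDecomposition (isHomogeneous_map_algebraMap p hp)
  have : SetLike.GradedSMul (locRingDeg 𝒜 p) (resField 𝒜 p).deg := quotDeg_gradedSMul _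
  have quot_mem : ∀ g, ∀ x ∈ quotDeg 𝒜 p g, quotLocalization (LocRing 𝒜 p) (homCompl 𝒜 p) p x ∈
      quotDeg (locRingDeg 𝒜 p) (p.map (algebraMap R (LocRing 𝒜 p))) g := by
    rintro g _ ⟨x, hx, rfl⟩
    exact ⟨algebraMap R _ x, algebraMap_mem_locRingDeg hx, rfl⟩
  rw [← P.mem_extSupport_localize_iff (homCompl 𝒜 p) (B := LocRing 𝒜 p) (ℬ := locRingDeg 𝒜 p)
    (fun _ _ => algebraMap_mem_locRingDeg) _ quot_mem isFractionGrading_locModDeg fun s => s.2.1,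
    starExtDeg_ne_bot_iff]
  exact Set.ext_iff.mp (GradedFreeResolution.extSupport_eq (𝒩 := (resField 𝒜 p).deg) _ _) a

end ResidueRing

/-! ### Coarsening and stable classes -/

section Components

variable {G A M ι : Type*} [AddCommGroup G] [CommRing A] [AddCommGroup M] [Module A M]

theorem exists_smul_sum_mem {α : Type*} {F : Finset α} {x : α → M} {S : Submonoid A}
    {K : Submodule A M} (h : ∀ n ∈ F, ∃ s ∈ S, s • x n ∈ K) : ∃ s ∈ S, s • ∑ n ∈ F, x n ∈ K := by
  classical
  choose! s hs hx using h
  refine ⟨∏ n ∈ F, s n, prod_mem hs, ?_⟩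
  rw [Finset.smul_sum]
  refine sum_mem fun n hn => ?_
  rw [← Finset.prod_erase_mul _ _ hn, mul_smul]
  exact K.smul_mem _ (hx n hn)

variable [DecidableEq G] {𝒜 : G → AddSubgroup A} {ℳ : G → AddSubgroup M} [Decomposition ℳ]

theorem linearComponent_smul [Decomposition 𝒜] [SetLike.GradedSMul 𝒜 ℳ] {δ : ι → G} {b : G}
    {f : (ι →₀ A) →ₗ[A] M} (hf : f ∈ homDeg δ ℳ b) (g : G) (c : A) :
    linearComponent δ ℳ (g + b) (c • f) = proj 𝒜 g c • f :=
  Finsupp.lhom_ext' fun j => LinearMap.ext_ring <| by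
    simp only [LinearMap.comp_apply, Finsupp.lsingle_apply, linearComponent_single_one,
      LinearMap.smul_apply]
    exact proj_smul_of_mem_right c (hf j) (add_left_comm _ _ _)

theorem exists_eq_sum_linearComponent [Finite ι] (δ : ι → G) (f : (ι →₀ A) →ₗ[A] M) :
    ∃ F : Finset G, f = ∑ n ∈ F, linearComponent δ ℳ n f := by
  have := Fintype.ofFinite ι
  choose s hs0 hs using fun j => exists_eq_sum_proj ℳ (f (Finsupp.single j 1))
  refine ⟨Finset.univ.biUnion fun j => (s j).image (· - δ j),
    Finsupp.lhom_ext' fun j => LinearMap.ext_ring ?_⟩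
  simp only [LinearMap.comp_apply, Finsupp.lsingle_apply, LinearMap.sum_apply,
    linearComponent_single_one]
  rw [← Finset.sum_subset (Finset.subset_biUnion_of_mem (fun j => (s j).image (· - δ j))
    (Finset.mem_univ j)), Finset.sum_image fun _ _ _ _ h => sub_left_injective h]
  · simp only [add_sub_cancel, hs]
  · exact fun n _ hn => hs0 j _ fun hmem => hn (Finset.mem_image.mpr ⟨_, hmem, by abel⟩)

namespace GradedFreeResolution

variable {N : Type*} [AddCommGroup N] [Module A N] {𝒩 : G → AddSubgroup N}
  (P : GradedFreeResolution 𝒜 𝒩) [SetLike.GradedSMul 𝒜 ℳ] {i : ℕ} {f : (P.ι i →₀ A) →ₗ[A] M}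

theorem linearComponent_mem_homCoboundaries (hf : f ∈ P.homCoboundaries M i) (a : G) :
    linearComponent (P.δ i) ℳ a f ∈ P.homCoboundaries M i := by
  cases i with
  | zero =>
    rw [show f = 0 from hf, linearComponent_of_mem (zero_mem _)]
    exact zero_mem _
  | succ i =>
    obtain ⟨g, rfl⟩ := hf
    exact ⟨linearComponent (P.δ i) ℳ a g, linearComponent_comp g (P.d_mem i)⟩

theorem linearComponent_mem_homCocycles (hf : f ∈ P.homCocycles M i) (a : G) :
    linearComponent (P.δ i) ℳ a f ∈ P.homCocycles M i := by
  rw [mem_homCocycles] at hf ⊢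
  rw [linearComponent_comp f (P.d_mem i), hf, linearComponent_of_mem (zero_mem _)]

end GradedFreeResolution

end Components

section CoarsenResolution

variable {G H : Type} [AddCommGroup G] [AddCommGroup H] {A M : Type*} [CommRing A]
  [AddCommGroup M] [Module A M] {𝒜 : G → AddSubgroup A} {ℳ : G → AddSubgroup M} {ι : Type*}
  {δ : ι → G} {φ : G →+ H} {f : (ι →₀ A) →ₗ[A] M}

theorem mem_homDeg_coarsen {n : G} (hf : f ∈ homDeg δ ℳ n) :
    f ∈ homDeg (φ ∘ δ) (coarsen φ ℳ) (φ n) := fun j => by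
  rw [Function.comp_apply, ← map_add]
  exact le_coarsen φ ℳ _ (hf j)

theorem linearComponent_eq_zero_of_mem_homDeg_coarsen [DecidableEq G] [Decomposition ℳ] {n : G}
    {a : H} (hf : f ∈ homDeg (φ ∘ δ) (coarsen φ ℳ) a) (hn : φ n ≠ a) :
    linearComponent δ ℳ n f = 0 :=
  Finsupp.lhom_ext' fun j => LinearMap.ext_ring <|
    (linearComponent_single_one f j).trans <| proj_eq_zero_of_mem_coarsen (hf j) fun h =>
      hn (add_left_cancel ((map_add φ _ _).symm.trans h))

theorem exists_proj_mem_homCompl [DecidableEq G] [SetLike.GradedMonoid 𝒜] [Decomposition 𝒜]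
    {p : Ideal A} [p.IsPrime] {t : A} (ht : t ∉ p) : ∃ g, proj 𝒜 g t ∈ homCompl 𝒜 p := by
  by_contra! h
  refine ht (mem_of_forall_proj_mem (𝒩 := 𝒜) (K := p.toAddSubgroup) fun g => ?_)
  by_contra hg
  exact h g ⟨⟨g, proj_mem g t⟩, hg⟩

namespace GradedFreeResolution

variable {N : Type*} [AddCommGroup N] [Module A N] {𝒩 : G → AddSubgroup N}
  {𝒩' : H → AddSubgroup N}

/-- A graded free resolution considered with coarser gradings. -/
def coarsen (P : GradedFreeResolution.{w} 𝒜 𝒩) (φ : G →+ H) (h𝒩 : ∀ g, 𝒩 g ≤ 𝒩' (φ g)) :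
    GradedFreeResolution.{w} (coarsen φ 𝒜) 𝒩' where
  ι := P.ι
  δ n := φ ∘ P.δ n
  d := P.d
  ε := P.ε
  d_mem n j k := by
    rw [Function.comp_apply, Function.comp_apply, ← map_zero φ, ← map_add, ← map_sub]
    exact le_coarsen φ 𝒜 _ (P.d_mem n j k)
  ε_mem j := by
    rw [Function.comp_apply, ← map_zero φ, ← map_add]
    exact h𝒩 _ (P.ε_mem j)
  ε_surjective := P.ε_surjective
  exact_zero := P.exact_zero
  exact_succ := P.exact_succ

theorem homCoboundaries_coarsen (P : GradedFreeResolution 𝒜 𝒩) (h𝒩 : ∀ g, 𝒩 g ≤ 𝒩' (φ g))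
    (i : ℕ) : (P.coarsen φ h𝒩).homCoboundaries M i = P.homCoboundaries M i := by
  cases i <;> rfl

variable [DecidableEq G] [SetLike.GradedSMul 𝒜 ℳ] [Decomposition ℳ]

theorem exists_mem_stableDegrees_of_mem_homDeg_coarsen (P : GradedFreeResolution 𝒜 𝒩) {i : ℕ}
    [Finite (P.ι i)] {S : Submonoid A} {f : (P.ι i →₀ A) →ₗ[A] M} {a : H}
    (hf_deg : f ∈ homDeg (φ ∘ P.δ i) (MultiGraded.coarsen φ ℳ) a) (hf : f ∈ P.homCocycles M i)
    (hf_stable : ∀ t ∈ S, t • f ∉ P.homCoboundaries M i) :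
    ∃ n ∈ P.stableDegrees S ℳ i, φ n = a := by
  by_contra! hunstable
  obtain ⟨F, hF⟩ := exists_eq_sum_linearComponent (ℳ := ℳ) (P.δ i) f
  have hkill : ∀ n ∈ F, ∃ s ∈ S, s • linearComponent (P.δ i) ℳ n f ∈ P.homCoboundaries M i := by
    intro n _
    by_cases hn : φ n = a
    · by_contra! hstable
      exact hunstable n
        ⟨_, linearComponent_mem f, P.linearComponent_mem_homCocycles hf n, hstable⟩ hn
    · refine ⟨1, one_mem _, ?_⟩
      rw [linearComponent_eq_zero_of_mem_homDeg_coarsen hf_deg hn, smul_zero]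
      exact zero_mem _
  obtain ⟨s, hs, hsf⟩ := exists_smul_sum_mem hkill
  exact hf_stable s hs (hF ▸ hsf)

theorem stableDegrees_coarsen [SetLike.GradedMonoid 𝒜] [Decomposition 𝒜] {p : Ideal A} [p.IsPrime]
    (P : GradedFreeResolution 𝒜 𝒩) [∀ n, Finite (P.ι n)]
    (h𝒩 : ∀ g, 𝒩 g ≤ 𝒩' (φ g)) (i : ℕ) :
    (P.coarsen φ h𝒩).stableDegrees (homCompl (MultiGraded.coarsen φ 𝒜) p)
      (MultiGraded.coarsen φ ℳ) i = φ '' P.stableDegrees (homCompl 𝒜 p) ℳ i := by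
  have homCompl_le : homCompl 𝒜 p ≤ homCompl (MultiGraded.coarsen φ 𝒜) p :=
    inf_le_inf_right _ fun _ ⟨g, hg⟩ => ⟨φ g, le_coarsen φ 𝒜 g hg⟩
  simp only [stableDegrees, homCoboundaries_coarsen]
  refine Set.Subset.antisymm ?_ ?_
  · rintro a ⟨f, hf_deg, hf, hf_stable⟩
    exact P.exists_mem_stableDegrees_of_mem_homDeg_coarsen hf_deg hf
      fun s hs => hf_stable s (homCompl_le hs)
  · rintro _ ⟨n, ⟨f, hf_deg, hf, hf_stable⟩, rfl⟩
    refine ⟨f, mem_homDeg_coarsen hf_deg, hf, fun t ht htf => ?_⟩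
    obtain ⟨g, hg⟩ := exists_proj_mem_homCompl (𝒜 := 𝒜) ht.2
    refine hf_stable _ hg ?_
    rw [← linearComponent_smul hf_deg]
    exact P.linearComponent_mem_homCoboundaries htf _

end GradedFreeResolution

end CoarsenResolution

section Finiteness

namespace GradedFreeResolution

variable {G H A M N : Type*} [AddCommGroup G] [AddCommGroup H] [CommRing A]
  [AddCommGroup M] [Module A M] [AddCommGroup N] [Module A N] {𝒜 : G → AddSubgroup A}
  {𝒩 : G → AddSubgroup N} {ℳ : G → AddSubgroup M} [DecidableEq G] [SetLike.GradedSMul 𝒜 ℳ]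
  [Decomposition ℳ]

theorem span_homogeneous_homCocycles (P : GradedFreeResolution 𝒜 𝒩) (i : ℕ) [Finite (P.ι i)] :
    Submodule.span A {f | f ∈ P.homCocycles M i ∧ ∃ n, f ∈ homDeg (P.δ i) ℳ n} =
      P.homCocycles M i := by
  refine le_antisymm (Submodule.span_le.mpr fun f hf => hf.1) fun f hf => ?_
  obtain ⟨F, hF⟩ := exists_eq_sum_linearComponent (ℳ := ℳ) (P.δ i) f
  rw [hF]
  exact sum_mem fun n _ => Submodule.subset_span
    ⟨P.linearComponent_mem_homCocycles hf n, n, linearComponent_mem f⟩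

variable [Decomposition 𝒜]

theorem linearComponent_mem_homCoboundaries_of_mem_span (P : GradedFreeResolution 𝒜 𝒩) {φ : G →+ H}
    (hφ : ∀ g, φ g ≠ 0 → ∀ c ∈ 𝒜 g, ∀ x : N, c • x = 0) {i : ℕ}
    {s : Set ((P.ι i →₀ A) →ₗ[A] M)} {n : G}
    (hs : ∀ z ∈ s, z ∈ P.homCocycles M i ∧ ∃ k, z ∈ homDeg (P.δ i) ℳ k ∧ φ k ≠ φ n)
    {f : (P.ι i →₀ A) →ₗ[A] M} (hf : f ∈ Submodule.span A s) :
    linearComponent (P.δ i) ℳ n f ∈ P.homCoboundaries M i := by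
  induction hf using Submodule.closure_induction with
  | zero =>
    rw [linearComponent_of_mem (zero_mem _)]
    exact zero_mem _
  | add f f' _ _ hf hf' =>
    rw [linearComponent_add]
    exact add_mem hf hf'
  | smul_mem c z hz =>
    obtain ⟨hz, k, hzk, hk⟩ := hs z hz
    rw [← sub_add_cancel n k, linearComponent_smul (𝒜 := 𝒜) hzk]
    refine P.smul_mem_homCoboundaries_of_annihilates (hφ _ ?_ _ (proj_mem _ _)) hz
    rwa [map_sub, sub_ne_zero, ne_comm]

theorem finite_image_stableDegrees [IsNoetherianRing A] [Module.Finite A M]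
    (P : GradedFreeResolution 𝒜 𝒩) {i : ℕ} [Finite (P.ι i)] {φ : G →+ H}
    (hφ : ∀ g, φ g ≠ 0 → ∀ c ∈ 𝒜 g, ∀ x : N, c • x = 0) (S : Submonoid A) :
    (φ '' P.stableDegrees S ℳ i).Finite := by
  have hfg : (P.homCocycles M i).FG := IsNoetherian.noetherian _
  rw [← P.span_homogeneous_homCocycles (ℳ := ℳ),
    Submodule.fg_span_iff_fg_span_finset_subset] at hfg
  obtain ⟨s, hs, hspan⟩ := hfg
  choose! k hk using fun z (hz : z ∈ s) => (hs hz).2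
  refine (s.finite_toSet.image (φ ∘ k)).subset ?_
  rintro _ ⟨n, ⟨f, hf_deg, hf, hf_stable⟩, rfl⟩
  by_contra hn
  refine hf_stable 1 (one_mem _) ?_
  rw [one_smul, ← linearComponent_of_mem hf_deg]
  refine P.linearComponent_mem_homCoboundaries_of_mem_span hφ (s := s)
    (fun z hz => ⟨(hs hz).1, k z, hk z hz, fun h => hn ⟨z, hz, h⟩⟩) ?_
  rwa [← hspan, P.span_homogeneous_homCocycles]

end GradedFreeResolution

end Finiteness

/-! ### Anchor points under coarsening -/

section Directions

variable {r : ℕ} {R : Type*} [CommRing R] {𝒜 : (Fin r → ℤ) → AddSubgroup R} {p : Ideal R}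

theorem dirMap_of_dir_eq_univ (hdir : dir 𝒜 p = Finset.univ) (h : numDir 𝒜 p = r)
    (n : Fin r → ℤ) : dirMap 𝒜 p n = n ∘ Fin.cast h := by
  have hcast : Fin.cast h = (dir 𝒜 p).orderEmbOfFin rfl :=
    Finset.orderEmbOfFin_unique rfl (by simp [hdir]) fun _ _ hkl => hkl
  exact congrArg (n ∘ ·) hcast.symm

theorem mem_dir {j : Fin r} : j ∈ dir 𝒜 p ↔ (𝒜 (Pi.single j 1) : Set R) ⊆ p := by
  simp [dir]

variable [GradedRing 𝒜]

theorem exists_sub_mem_of_mem_dir (hstd : IsStandard 𝒜) {j : Fin r} (hj : j ∈ dir 𝒜 p) (x : R) :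
    ∃ w ∈ coarsen (Pi.evalAddMonoidHom (fun _ => ℤ) j) 𝒜 0, x - w ∈ p := by
  let B : Subring R := SetLike.GradeZero.subring (coarsen (Pi.evalAddMonoidHom (fun _ => ℤ) j) 𝒜)
  have generators_subset : (𝒜 0 : Set R) ∪ ⋃ k, (𝒜 (Pi.single k 1) : Set R) ⊆
      (B.map (Ideal.Quotient.mk p)).comap (Ideal.Quotient.mk p) := by
    refine Set.union_subset (fun y hy => ⟨y, ?_, rfl⟩) (Set.iUnion_subset fun k y hy => ?_)
    · exact le_coarsen (Pi.evalAddMonoidHom (fun _ => ℤ) j) 𝒜 0 hy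
    · obtain rfl | hkj := eq_or_ne k j
      · have hyp : y ∈ p := mem_dir.mp hj hy
        exact ⟨0, zero_mem B, by rw [map_zero, Ideal.Quotient.eq_zero_iff_mem.mpr hyp]⟩
      · have hyB := le_coarsen (Pi.evalAddMonoidHom (fun _ => ℤ) j) 𝒜 _ hy
        rw [Pi.evalAddMonoidHom_apply, Pi.single_eq_of_ne' hkj] at hyB
        exact ⟨y, hyB, rfl⟩
  have closure_le := Subring.closure_le.mpr generators_subset
  rw [show Subring.closure _ = ⊤ from hstd] at closure_le
  obtain ⟨w, hw, hwx⟩ := closure_le (Subring.mem_top x)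
  exact ⟨w, hw, Ideal.Quotient.eq.mp hwx.symm⟩

theorem mem_of_mem_dir (hstd : IsStandard 𝒜) (hp : p.IsHomogeneous 𝒜) {j : Fin r}
    (hj : j ∈ dir 𝒜 p) {n : Fin r → ℤ} (hn : n j ≠ 0) {x : R} (hx : x ∈ 𝒜 n) : x ∈ p := by
  obtain ⟨w, hw, hxw⟩ := exists_sub_mem_of_mem_dir hstd hj x
  have hproj : proj 𝒜 n (x - w) ∈ p := hp n hxw
  rwa [map_sub, proj_of_mem hx, proj_eq_zero_of_mem_coarsen hw hn, sub_zero] at hproj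

theorem mem_of_dirMap_ne_zero (hstd : IsStandard 𝒜) (hp : p.IsHomogeneous 𝒜) {n : Fin r → ℤ}
    (hn : dirMap 𝒜 p n ≠ 0) {x : R} (hx : x ∈ 𝒜 n) : x ∈ p := by
  obtain ⟨k, hk⟩ := Function.ne_iff.mp hn
  exact mem_of_mem_dir hstd hp (Finset.orderEmbOfFin_mem (dir 𝒜 p) rfl k) hk hx

theorem mem_of_mem_coarsen_dirMap (hstd : IsStandard 𝒜) (hp : p.IsHomogeneous 𝒜)
    {a : Fin (numDir 𝒜 p) → ℤ} (ha : a ≠ 0) {x : R} (hx : x ∈ coarsen (dirMap 𝒜 p) 𝒜 a) :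
    x ∈ p := by
  have hle : coarsen (dirMap 𝒜 p) 𝒜 a ≤ p.toAddSubgroup :=
    iSup₂_le fun n hn y hy => mem_of_dirMap_ne_zero hstd hp (hn ▸ ha) hy
  exact hle hx

theorem dir_coarsen (hstd : IsStandard 𝒜) (hp : p.IsHomogeneous 𝒜) :
    dir (coarsen (dirMap 𝒜 p) 𝒜) p = Finset.univ :=
  Finset.eq_univ_of_forall fun _ => mem_dir.mpr fun _ hx =>
    mem_of_mem_coarsen_dirMap hstd hp (by simp) hx

theorem numDir_coarsen (hstd : IsStandard 𝒜) (hp : p.IsHomogeneous 𝒜) :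
    numDir (coarsen (dirMap 𝒜 p) 𝒜) p = numDir 𝒜 p := by
  rw [numDir, dir_coarsen hstd hp, Finset.card_univ, Fintype.card_fin]

end Directions

section Anchor

variable {r : ℕ} {R : Type u} [CommRing R] {𝒜 : (Fin r → ℤ) → AddSubgroup R}
  [SetLike.GradedMonoid 𝒜] [Decomposition 𝒜] {p : Ideal R} [p.IsPrime] {M : Type v}
  [AddCommGroup M] [Module R M] {ℳ : (Fin r → ℤ) → AddSubgroup M} [SetLike.GradedSMul 𝒜 ℳ]
  [Decomposition ℳ]

theorem anch_eq_image_stableDegrees (hp : SetLike.IsHomogeneous 𝒜 p)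
    (hdir : ∀ n, dirMap 𝒜 p n ≠ 0 → ∀ x ∈ 𝒜 n, x ∈ p)
    (P : GradedFreeResolution.{w} 𝒜 (quotDeg 𝒜 p)) [∀ n, Finite (P.ι n)] (i : ℕ) :
    anch 𝒜 p ℳ i = dirMap 𝒜 p '' P.stableDegrees (homCompl 𝒜 p) ℳ i := by
  ext a
  have mem_anch_iff : a ∈ anch 𝒜 p ℳ i ↔ ∃ n, dirMap 𝒜 p n = a ∧ ∃ d, ∃ s ∈ homCompl 𝒜 p,
      s ∈ 𝒜 d ∧ n + d ∈ P.stableDegrees (homCompl 𝒜 p) ℳ i := by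
    simp only [anch, Set.mem_ofPred_eq, ne_eq, coarsen_eq_bot_iff, not_forall, exists_prop,
      ← starExtDeg_resField_ne_bot_iff hp P]
  rw [mem_anch_iff]
  constructor
  · rintro ⟨n, rfl, d, s, hs, hsd, hstable⟩
    have hd : dirMap 𝒜 p d = 0 := by
      by_contra h
      exact hs.2 (hdir d h s hsd)
    exact ⟨n + d, hstable, by rw [map_add, hd, add_zero]⟩
  · rintro ⟨n, hstable, rfl⟩
    exact ⟨n, rfl, 0, 1, one_mem _, SetLike.GradedOne.one_mem, by rwa [add_zero]⟩

end Anchor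

end MultiGraded

end

open MultiGraded in
theorem theorem2p10_general {r : ℕ} {R : Type*} [CommRing R] [IsNoetherianRing R]
    (𝒜 : (Fin r → ℤ) → AddSubgroup R) [GradedRing 𝒜] (hstd : IsStandard 𝒜)
    {M : Type*} [AddCommGroup M] [Module R M]
    (ℳ : (Fin r → ℤ) → AddSubgroup M) [DirectSum.Decomposition ℳ] [SetLike.GradedSMul 𝒜 ℳ]
    (i : ℕ) (p : Ideal R) [p.IsPrime] (hp : p.IsHomogeneous 𝒜) :
    (∃ h : numDir (coarsen (dirMap 𝒜 p) 𝒜) p = numDir 𝒜 p,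
      anch 𝒜 p ℳ i =
        {a | a ∘ Fin.cast h ∈ anch (coarsen (dirMap 𝒜 p) 𝒜) p (coarsen (dirMap 𝒜 p) ℳ) i}) ∧
    (Module.Finite R M → (anch 𝒜 p ℳ i).Finite) := by
  have hdir (n) (hn : dirMap 𝒜 p n ≠ 0) (x) (hx : x ∈ 𝒜 n) : x ∈ p :=
    mem_of_dirMap_ne_zero hstd hp hn hx
  let := quotDecomposition hp
  obtain ⟨P, hP⟩ := exists_finite_resolution (𝒜 := 𝒜) (𝒩 := quotDeg 𝒜 p)
  have hanch := anch_eq_image_stableDegrees (ℳ := ℳ) hp hdir P i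
  refine ⟨⟨numDir_coarsen hstd hp, ?_⟩, fun _ => ?_⟩
  · let Q := P.coarsen (dirMap 𝒜 p) (𝒩' := quotDeg (coarsen (dirMap 𝒜 p) 𝒜) p)
      fun g => AddSubgroup.map_mono (le_coarsen _ 𝒜 g)
    have : ∀ n, Finite (Q.ι n) := hP
    rw [hanch, anch_eq_image_stableDegrees (isHomogeneous_coarsen (K := p.toAddSubgroup) hp)
        (fun n hn x hx => mem_of_mem_coarsen_dirMap hstd hp (ne_zero_of_map hn) hx) Q,
      P.stableDegrees_coarsen,
      funext (dirMap_of_dir_eq_univ (dir_coarsen hstd hp) (numDir_coarsen hstd hp))]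
    exact ((finCongr (numDir_coarsen hstd hp)).surjective.injective_comp_right.preimage_image
      _).symm
  · rw [hanch]
    refine P.finite_image_stableDegrees (fun n hn c hc x => ?_) _
    obtain ⟨x, rfl⟩ := Ideal.Quotient.mk_surjective x
    exact Ideal.Quotient.eq_zero_iff_mem.mpr (p.mul_mem_right x (hdir n hn c hc))

theorem theorem2p10 {r : ℕ} {R : Type*} [CommRing R] [IsNoetherianRing R]
    (𝒜 : (Fin r → ℤ) → AddSubgroup R) [GradedRing 𝒜]
    (hpos : MultiGraded.IsPositivelyGraded 𝒜) (hstd : MultiGraded.IsStandard 𝒜)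
    {M : Type*} [AddCommGroup M] [Module R M]
    (ℳ : (Fin r → ℤ) → AddSubgroup M) [DirectSum.Decomposition ℳ] [SetLike.GradedSMul 𝒜 ℳ]
    (i : ℕ) (p : Ideal R) [p.IsPrime] (hp : p.IsHomogeneous 𝒜)
    (hp1 : Ideal.span (𝒜 1 : Set R) ≤ p) :
    (∃ h : MultiGraded.numDir (MultiGraded.coarsen (MultiGraded.dirMap 𝒜 p) 𝒜) p
          = MultiGraded.numDir 𝒜 p,
      MultiGraded.anch 𝒜 p ℳ i =
        {a | a ∘ Fin.cast h ∈
          MultiGraded.anch (MultiGraded.coarsen (MultiGraded.dirMap 𝒜 p) 𝒜) p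
            (MultiGraded.coarsen (MultiGraded.dirMap 𝒜 p) ℳ) i}) ∧
    (Module.Finite R M → (MultiGraded.anch 𝒜 p ℳ i).Finite) :=
  theorem2p10_general 𝒜 hstd ℳ i p hp
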